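/- Consider the sparse linear regression model with parameter $\theta\in\mathbb{R}^d$: $(X_1,y_1),\dots,(X_n,y_n)$ are i.i.d. with $X_i\sim N(0,I_d)$, $\xi_i\sim N(0,1)$ independent of $X_i$, and $y_i=\langle X_i,\theta\rangle+\xi_i$, where $\theta$ is known to be $s$-sparse, i.e. has at most $s$ nonzero coordinates ($s$ a real number). In the $\varepsilon$-corruption model, an adversary who sees all $n$ samples (and may use its own randomness) replaces at most $\varepsilon n$ of them arbitrarily. For $\gamma>0$ we say that a (possibly randomized) algorithm, which maps $n$ observations to "accept" or "reject", distinguishes $\|\theta\|_2=0$ from $\|\theta\|_2\ge\gamma$ from $\varepsilon$-corrupted samples if, for every such adversary, it accepts with probability greater than $2/3$ when $\theta=0$ and rejects with probability greater than $2/3$ for every $s$-sparse $\theta$ with $\|\theta\|_2\ge\gamma$. **Theorem.** There are absolute constants $\gamma_0>0$ and $C_0>0$ such that for every $C\ge C_0$ and every $\delta\in(0,1)$ there is a constant $c=c(C,\delta)>0$ with the following property. Let $d,n\ge 0$ be integers, $0<\gamma\le\gamma_0$, $\varepsilon=\gamma/C$ and $s=d^{1-\delta}$. If some algorithm distinguishes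 $\|\theta\|_2=0$ from $\|\theta\|_2\ge\gamma$ from $n$ $\varepsilon$-corrupted samples of the sparse linear regression model with sparsity $s$, then $$n\;\ge\; c\,\min\Bigl(s\log d,\ \frac1{\gamma^4}\Bigr)$$ (for $d=0$ the right-hand side is read as $0$). -/

import Mathlib

open MeasureTheory ProbabilityTheory

noncomputable section

/-- One observation of a linear regression model: a covariate in `ℝ^d` and a real response. -/
abbrev Observation (d : ℕ) : Type := EuclideanSpace ℝ (Fin d) × ℝ

/-- The law of `(X, y)`, where `y = ⟨X, θ⟩ + ξ` with `X ~ N(0, I_d)` and `ξ ~ N(0, 1)` independent. -/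
def regressionLaw {d : ℕ} (θ : EuclideanSpace ℝ (Fin d)) : Measure (Observation d) :=
  ((stdGaussian (EuclideanSpace ℝ (Fin d))).prod (gaussianReal 0 1)).map
    (fun p => (p.1, inner ℝ p.1 θ + p.2))

/-- `θ` has at most `s` nonzero coordinates (`s` is a real number, not necessarily an integer). -/
def IsSparse {d : ℕ} (s : ℝ) (θ : EuclideanSpace ℝ (Fin d)) : Prop :=
  ({j : Fin d | θ j ≠ 0}.ncard : ℝ) ≤ s

/-- `Q` is a possible law of an `ε`-corrupted data set of `n` i.i.d. samples from `P`: there is a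
joint law `π` of a clean data set, which consists of `n` i.i.d. samples from `P`, and of a corrupted
data set with law `Q`, such that almost surely the two differ in at most `ε n` of the samples.
The adversary sees all the clean samples and may use randomness of its own. -/
def IsCorruptedLaw {S : Type*} [MeasurableSpace S] (ε : ℝ) (n : ℕ) (P : Measure S)
    (Q : Measure (Fin n → S)) : Prop :=
  ∃ π : Measure ((Fin n → S) × (Fin n → S)),
    π.map Prod.fst = Measure.pi (fun _ : Fin n => P) ∧
    π.map Prod.snd = Q ∧
    ∀ᵐ z ∂π, ({i : Fin n | z.2 i ≠ z.1 i}.ncard : ℝ) ≤ ε * n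

/-- The (possibly randomized) algorithm `T`, which maps a data set of `n` observations to a random
bit (`false` for "accept", `true` for "reject"), distinguishes `‖θ‖ = 0` from `‖θ‖ ≥ γ`
over `s`-sparse `θ` with probability greater than `2/3`, from `ε`-corrupted samples. -/
def RobustlyDistinguishes {d n : ℕ} (T : Kernel (Fin n → Observation d) Bool)
    (s ε γ : ℝ) : Prop :=
  ∀ θ : EuclideanSpace ℝ (Fin d), IsSparse s θ →
    ∀ Q : Measure (Fin n → Observation d), IsCorruptedLaw ε n (regressionLaw θ) Q →
      (‖θ‖ = 0 → 2 / 3 < (Q.bind T) {false}) ∧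
      (γ ≤ ‖θ‖ → 2 / 3 < (Q.bind T) {true})

end

/-! Take `θ = a v` with `a = γ` and `v` a random sparse unit vector. Relative to the null law, a
sample has density `1 + a u y + O(a²)`, where `u = ⟨X, v⟩`. The adversary has budget of order `a`,
so it can afford to change the linear term itself. It replaces `u` by a bounded function `g u` that
is `L¹`-close to `u` but orthogonal to `1` and `u` in Gaussian space
(`exists_bounded_orthogonal_approx`), and truncates `y` so that the density stays nonnegative. The
total variation cost is `a (τ + O(a))` (`lintegral_density_sub_le`). A maximal coupling of single
samples and Markov's inequality for the number of moved samples turn this into a legal corruption,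
up to a small error (`exists_isCorruptedLaw_hiddenDensity`).

The gain is in the pairwise correlations. For two directions with inner product `ρ`, the excess
correlation of the hidden densities would be of order `a² ρ` with `u` itself. With `g` the Mehler
kernel loses its terms of order `1` and `ρ`, which leaves `O(a² ρ²)`
(`integral_hiddenDensity_mul_le`).

The second moment method (`average_integral_prod_sub_le`) then needs the average of `exp (n D ρ²)`
over pairs of directions to be close to `1`. Splitting the coordinates into `k` blocks and choosing
one signed coordinate per block makes `k ρ` a Rademacher sum over the blocks where the choices
agree. Its square-exponential moment is controlled while `n` is below a small multiple of `s log d`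
(`sum_exp_sq_signedOverlap_le_of_sparse`). The term `1 / γ⁴` serves only to absorb values of `γ` too
large for the expansion. -/

/-! ### Linear statistics of a standard Gaussian vector. -/

lemma charFunDual_gaussianReal_zero_one (L : StrongDual ℝ ℝ) :
    charFunDual (gaussianReal 0 1) L = Complex.exp (-((L 1 : ℝ) : ℂ) ^ 2 / 2) := by
  have h : ∀ x : ℝ, L x = L 1 * x := fun x => by
    have := L.map_smul x 1
    rw [smul_eq_mul, mul_one, smul_eq_mul] at this
    rw [this, mul_comm]
  rw [charFunDual_apply]
  have h' : (fun x : ℝ => Complex.exp (L x * Complex.I)) =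
      fun x : ℝ => Complex.exp ((L 1 : ℝ) * x * Complex.I) := by
    ext x; rw [h x, Complex.ofReal_mul]
  rw [h', ← charFun_apply_real, charFun_gaussianReal]
  simp [neg_div]

section InnerPair

variable {E : Type*} [NormedAddCommGroup E] [InnerProductSpace ℝ E] [FiniteDimensional ℝ E]
  [MeasurableSpace E] [BorelSpace E]

/-- Two unit-norm linear statistics of a standard Gaussian vector are a correlated Gaussian pair. -/
lemma stdGaussian_map_inner_pair {v w : E} (hv : ‖v‖ = 1) (hw : ‖w‖ = 1) :
    (stdGaussian E).map (fun x => (inner ℝ x v, inner ℝ x w)) =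
      ((gaussianReal 0 1).prod (gaussianReal 0 1)).map
        (fun p : ℝ × ℝ =>
          (p.1, inner ℝ v w * p.1 + Real.sqrt (1 - (inner ℝ v w) ^ 2) * p.2)) := by
  set ρ : ℝ := inner ℝ v w with hρ
  have hρ1 : ρ ^ 2 ≤ 1 := by
    have := abs_real_inner_le_norm v w
    rw [hv, hw, one_mul] at this
    exact (sq_le_one_iff_abs_le_one _).2 this
  let T : E →L[ℝ] ℝ × ℝ := (innerSL ℝ v).prod (innerSL ℝ w)
  let U : ℝ × ℝ →L[ℝ] ℝ × ℝ := (ContinuousLinearMap.fst ℝ ℝ ℝ).prod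
    (ρ • ContinuousLinearMap.fst ℝ ℝ ℝ + Real.sqrt (1 - ρ ^ 2) • ContinuousLinearMap.snd ℝ ℝ ℝ)
  have hT : (fun x : E => ((inner ℝ x v : ℝ), (inner ℝ x w : ℝ))) = T := by
    ext x <;> simp [T, real_inner_comm]
  have hU : (fun p : ℝ × ℝ => (p.1, ρ * p.1 + Real.sqrt (1 - ρ ^ 2) * p.2)) = U := by
    ext x <;> simp [U]
  rw [hT, hU]
  have hmT : IsProbabilityMeasure ((stdGaussian E).map T) :=
    Measure.isProbabilityMeasure_map T.continuous.aemeasurable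
  have hmU : IsProbabilityMeasure (((gaussianReal 0 1).prod (gaussianReal 0 1)).map U) :=
    Measure.isProbabilityMeasure_map U.continuous.aemeasurable
  -- Both sides are linear images of standard Gaussians. Their characteristic functions agree
  -- because both quadratic forms are `α² + 2αβρ + β²`, with `α = L (1, 0)` and `β = L (0, 1)`.
  apply Measure.ext_of_charFunDual
  ext L
  have hL : ∀ a b : ℝ, L (a, b) = a * L (1, 0) + b * L (0, 1) := fun a b => by
    have : ((a, b) : ℝ × ℝ) = a • (1, 0) + b • (0, 1) := by simp
    rw [this, L.map_add, L.map_smul, L.map_smul]; simp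
  rw [charFunDual_map, charFunDual_map, charFunDual_stdGaussian, charFunDual_prod,
    charFunDual_gaussianReal_zero_one, charFunDual_gaussianReal_zero_one, ← Complex.exp_add]
  have h1 : L.comp T = innerSL ℝ (L (1, 0) • v + L (0, 1) • w) := by
    ext x
    change L (inner ℝ v x, inner ℝ w x) = inner ℝ (L (1, 0) • v + L (0, 1) • w) x
    rw [hL, inner_add_left, real_inner_smul_left, real_inner_smul_left]
    ring
  have h2 : ‖L.comp T‖ ^ 2 = L (1, 0) ^ 2 + 2 * L (1, 0) * L (0, 1) * ρ + L (0, 1) ^ 2 := by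
    rw [h1, innerSL_apply_norm, norm_add_sq_real, norm_smul, norm_smul, hv, hw, inner_smul_left,
      inner_smul_right, ← hρ]
    simp
    ring
  have h3 : ((L.comp U).comp (.inl ℝ ℝ ℝ)) 1 = L (1, 0) + ρ * L (0, 1) := by
    simp [U, hL 1 ρ]
  have h4 : ((L.comp U).comp (.inr ℝ ℝ ℝ)) 1 = Real.sqrt (1 - ρ ^ 2) * L (0, 1) := by
    simp [U, hL 0 (Real.sqrt _)]
  rw [h3, h4, ← Complex.ofReal_pow, h2]
  congr 1
  have h5 : (Real.sqrt (1 - ρ ^ 2)) ^ 2 = 1 - ρ ^ 2 := Real.sq_sqrt (by linarith)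
  rw [← Complex.ofReal_pow, ← Complex.ofReal_pow, mul_pow, h5]
  push_cast
  ring

lemma stdGaussian_map_inner {v : E} (hv : ‖v‖ = 1) :
    (stdGaussian E).map (fun x => (inner ℝ x v : ℝ)) = gaussianReal 0 1 := by
  have h := congrArg (Measure.map Prod.fst) (stdGaussian_map_inner_pair hv hv)
  rw [Measure.map_map measurable_fst (by fun_prop), Measure.map_map measurable_fst (by fun_prop)]
    at h
  have h1 : (Prod.fst ∘ fun x : E => ((inner ℝ x v : ℝ), (inner ℝ x v : ℝ)))
    = fun x => (inner ℝ x v : ℝ) := rfl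
  rw [h1] at h
  rw [h]
  change Measure.map Prod.fst _ = _
  simp

end InnerPair

/-! ### The Mehler kernel and second-order decorrelation. -/

/-- The density of the correlated Gaussian pair with respect to the product Gaussian. -/
noncomputable def mehlerKernel (ρ u x : ℝ) : ℝ :=
  (Real.sqrt (1 - ρ ^ 2))⁻¹ *
    Real.exp ((2 * ρ * u * x - ρ ^ 2 * (u ^ 2 + x ^ 2)) / (2 * (1 - ρ ^ 2)))

lemma measurable_mehlerKernel (ρ u : ℝ) : Measurable (mehlerKernel ρ u) := by
  unfold mehlerKernel; fun_prop

lemma abs_exp_sub_one_sub_id_le_mul_exp (x : ℝ) :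
    |Real.exp x - 1 - x| ≤ x ^ 2 * Real.exp |x| := by
  have := Complex.norm_exp_sub_sum_le_norm_mul_exp (x : ℂ) 2
  rw [Finset.sum_range_succ, Finset.sum_range_one] at this
  simp only [pow_zero, Nat.factorial_zero, Nat.cast_one, div_one, pow_one, Nat.factorial_one,
    Complex.norm_real, Real.norm_eq_abs, sq_abs] at this
  rw [← Real.norm_eq_abs, ← Complex.norm_real]
  push_cast
  rwa [sub_sub]

/-- On a bounded window the exponent is `ρ u x + O(ρ²)` and the prefactor is `1 + O(ρ²)`, so the
Taylor expansion at `ρ = 0` is uniform. The subtracted part is exactly what a function orthogonal to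
affine functions cannot see. -/
lemma abs_mehlerKernel_sub_le {R ρ u x : ℝ} (hρ : |ρ| ≤ 1 / 2) (hu : |u| ≤ R)
    (hx : |x| ≤ R) :
    |mehlerKernel ρ u x - 1 - ρ * u * x| ≤
      (2 * Real.exp (R ^ 2) + 4 * R ^ 4 * Real.exp (R ^ 2) + 2 * R ^ 2) * ρ ^ 2 := by
  have hR : 0 ≤ R := (abs_nonneg _).trans hu
  have hr : ρ ^ 2 ≤ 1 / 4 := by
    rw [← sq_abs]; nlinarith [abs_nonneg ρ]
  set s : ℝ := 1 - ρ ^ 2 with hs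
  have hs0 : 3 / 4 ≤ s := by linarith
  have hs1 : s ≤ 1 := by nlinarith [sq_nonneg ρ]
  set e : ℝ := (2 * ρ * u * x - ρ ^ 2 * (u ^ 2 + x ^ 2)) / (2 * s) with he
  have hux : |u * x| ≤ R ^ 2 := by
    rw [abs_mul, sq]; exact mul_le_mul hu hx (abs_nonneg _) hR
  have hu2 : u ^ 2 ≤ R ^ 2 := sq_le_sq.2 (by rwa [abs_of_nonneg hR])
  have hx2 : x ^ 2 ≤ R ^ 2 := sq_le_sq.2 (by rwa [abs_of_nonneg hR])
  have h1 : |e - ρ * u * x| ≤ 2 * R ^ 2 * ρ ^ 2 := by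
    have : e - ρ * u * x = (ρ ^ 2 * (ρ * (u * x) - (u ^ 2 + x ^ 2) / 2)) / s := by
      rw [he]; field_simp; rw [hs]; ring
    rw [this, abs_div, abs_mul, abs_of_nonneg (sq_nonneg ρ), abs_of_pos (by linarith : 0 < s),
      div_le_iff₀ (by linarith)]
    have h2 : |ρ * (u * x) - (u ^ 2 + x ^ 2) / 2| ≤ 3 / 2 * R ^ 2 := by
      calc _ ≤ |ρ * (u * x)| + |(u ^ 2 + x ^ 2) / 2| := abs_sub _ _
        _ ≤ 1 / 2 * R ^ 2 + R ^ 2 := by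
          gcongr
          · rw [abs_mul]; gcongr
          · rw [abs_of_nonneg (by positivity)]; linarith
        _ = _ := by ring
    nlinarith [mul_le_mul_of_nonneg_left h2 (sq_nonneg ρ),
      mul_nonneg (sq_nonneg ρ) (sq_nonneg R)]
  have h2 : |e| ≤ 2 * R ^ 2 * |ρ| := by
    calc |e| = |(e - ρ * u * x) + ρ * (u * x)| := by ring_nf
      _ ≤ |e - ρ * u * x| + |ρ * (u * x)| := abs_add_le _ _
      _ ≤ 2 * R ^ 2 * ρ ^ 2 + |ρ| * R ^ 2 := by
        gcongr
        rw [abs_mul]; gcongr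
      _ ≤ 2 * R ^ 2 * |ρ| := by
        rw [← sq_abs ρ]
        nlinarith [mul_nonneg (mul_nonneg (sq_nonneg R) (abs_nonneg ρ)) (sub_nonneg.2 hρ)]
  have h3 : |e| ≤ R ^ 2 := h2.trans (by nlinarith [sq_nonneg R])
  have h4 : Real.exp |e| ≤ Real.exp (R ^ 2) := Real.exp_le_exp.2 h3
  have h5 : |Real.exp e - 1 - e| ≤ 4 * R ^ 4 * Real.exp (R ^ 2) * ρ ^ 2 := by
    calc _ ≤ e ^ 2 * Real.exp |e| := abs_exp_sub_one_sub_id_le_mul_exp e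
      _ ≤ (2 * R ^ 2 * |ρ|) ^ 2 * Real.exp (R ^ 2) := by
        rw [← sq_abs e]; gcongr
      _ = _ := by rw [mul_pow, sq_abs]; ring
  have h6 : |(Real.sqrt s)⁻¹ - 1| ≤ 2 * ρ ^ 2 := by
    have hq : 0 < Real.sqrt s := Real.sqrt_pos.2 (by linarith)
    have hq1 : Real.sqrt s ≤ 1 := Real.sqrt_le_one.2 hs1
    have hqs : s ≤ Real.sqrt s := by
      nlinarith [Real.sq_sqrt (by linarith : 0 ≤ s)]
    have : 1 ≤ (Real.sqrt s)⁻¹ := (one_le_inv₀ hq).2 hq1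
    rw [abs_of_nonneg (by linarith)]
    have h7 : (Real.sqrt s)⁻¹ ≤ s⁻¹ := inv_anti₀ (by linarith) hqs
    have h8 : s⁻¹ ≤ 1 + 2 * ρ ^ 2 := by
      rw [inv_le_iff_one_le_mul₀ (by linarith)]
      nlinarith [sq_nonneg ρ]
    linarith
  have h9 : Real.exp e ≤ Real.exp (R ^ 2) := Real.exp_le_exp.2 ((le_abs_self _).trans h3)
  calc |mehlerKernel ρ u x - 1 - ρ * u * x|
      = |((Real.sqrt s)⁻¹ - 1) * Real.exp e + (Real.exp e - 1 - e) + (e - ρ * u * x)| := by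
        rw [mehlerKernel]; congr 1; rw [← hs, ← he]; ring
    _ ≤ |((Real.sqrt s)⁻¹ - 1) * Real.exp e| + |Real.exp e - 1 - e| + |e - ρ * u * x| :=
        abs_add_three _ _ _
    _ ≤ 2 * ρ ^ 2 * Real.exp (R ^ 2) + 4 * R ^ 4 * Real.exp (R ^ 2) * ρ ^ 2
        + 2 * R ^ 2 * ρ ^ 2 := by
        gcongr
        rw [abs_mul, Real.abs_exp]; gcongr
    _ = _ := by ring

/-- Given the first coordinate `u`, the second is `N(ρ u, 1 - ρ²)`. The Mehler kernel is the ratio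
of that density to the standard one. -/
lemma integral_comp_correlated_eq {g : ℝ → ℝ} (hg : Measurable g) {ρ : ℝ} (hρ : ρ ^ 2 < 1)
    (u : ℝ) :
    ∫ w, g (ρ * u + Real.sqrt (1 - ρ ^ 2) * w) ∂(gaussianReal 0 1) =
      ∫ x, mehlerKernel ρ u x * g x ∂(gaussianReal 0 1) := by
  have hs : 0 < 1 - ρ ^ 2 := by linarith
  set c : ℝ := Real.sqrt (1 - ρ ^ 2) with hc
  have hc2 : c ^ 2 = 1 - ρ ^ 2 := Real.sq_sqrt hs.le
  have hmap : (gaussianReal 0 1).map (fun w => ρ * u + c * w) =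
      gaussianReal (ρ * u) (1 - ρ ^ 2).toNNReal := by
    have h1 : (fun w => ρ * u + c * w) = (fun w => ρ * u + w) ∘ (fun w => c * w) := rfl
    rw [h1, ← Measure.map_map (by fun_prop) (by fun_prop), gaussianReal_map_const_mul,
      gaussianReal_map_const_add]
    congr 1
    · simp
    · ext; simp [hc2, hs.le]
  have h2 := integral_map (μ := gaussianReal 0 1) (φ := fun w => ρ * u + c * w) (f := g)
    (by fun_prop) hg.aestronglyMeasurable
  rw [← h2, hmap, integral_gaussianReal_eq_integral_smul (by simpa using hs),
    integral_gaussianReal_eq_integral_smul one_ne_zero]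
  congr 1
  ext x
  simp only [smul_eq_mul]
  rw [← mul_assoc]
  congr 1
  rw [gaussianPDFReal, gaussianPDFReal, mehlerKernel, ← hc]
  simp only [Real.coe_toNNReal _ hs.le, NNReal.coe_one, sub_zero, mul_one]
  rw [Real.sqrt_mul (by positivity), ← hc, mul_inv]
  have : Real.exp (-(x - ρ * u) ^ 2 / (2 * (1 - ρ ^ 2))) = Real.exp (-x ^ 2 / 2) *
      Real.exp ((2 * ρ * u * x - ρ ^ 2 * (u ^ 2 + x ^ 2)) / (2 * (1 - ρ ^ 2))) := by
    rw [← Real.exp_add]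
    congr 1
    field_simp
    ring
  rw [this]
  ring

lemma integrable_of_measurable_of_bounded {Ω : Type*} [MeasurableSpace Ω] {μ : Measure Ω}
    [IsFiniteMeasure μ] {f : Ω → ℝ} (hf : Measurable f) {R : ℝ} (h : ∀ x, |f x| ≤ R) :
    Integrable f μ :=
  Integrable.of_bound hf.aestronglyMeasurable R (ae_of_all _ h)

lemma abs_integral_le_of_bounded {Ω : Type*} [MeasurableSpace Ω] {μ : Measure Ω}
    [IsProbabilityMeasure μ] {f : Ω → ℝ} {R : ℝ} (h : ∀ x, |f x| ≤ R) :
    |∫ x, f x ∂μ| ≤ R := by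
  simpa using norm_integral_le_of_norm_le_const (μ := μ) (f := f) (C := R) (ae_of_all _ h)

lemma integrable_pow_gaussianReal (k : ℕ) : Integrable (fun x : ℝ => x ^ k) (gaussianReal 0 1) :=
  by
    by_cases hk : k = 0
    · subst hk; simp
    · have h := (memLp_id_gaussianReal (μ := 0) (v := 1) k).integrable_norm_pow hk
      refine (integrable_norm_iff (by fun_prop)).1 ?_
      simpa using h

lemma integral_sq_gaussianReal : ∫ x : ℝ, x ^ 2 ∂(gaussianReal 0 1) = 1 := by
  have h := variance_fun_id_gaussianReal (μ := 0) (v := 1)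
  rw [variance_of_integral_eq_zero (by fun_prop) (by simp)] at h
  simpa using h

/-- A function orthogonal to `1` and `x` in Gaussian space has correlation quadratic in `ρ`. -/
lemma abs_integral_correlated_le {g : ℝ → ℝ} (hg : Measurable g) {R : ℝ}
    (hb : ∀ x, |g x| ≤ R) (hsupp : ∀ x, R < |x| → g x = 0)
    (h0 : ∫ x, g x ∂(gaussianReal 0 1) = 0) (h1 : ∫ x, x * g x ∂(gaussianReal 0 1) = 0)
    (ρ : ℝ) :
    |∫ p : ℝ × ℝ, g p.1 * g (ρ * p.1 + Real.sqrt (1 - ρ ^ 2) * p.2)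
      ∂((gaussianReal 0 1).prod (gaussianReal 0 1))| ≤
      R ^ 2 * (4 + (2 * Real.exp (R ^ 2) + 4 * R ^ 4 * Real.exp (R ^ 2) + 2 * R ^ 2)) * ρ ^ 2 := by
  have hR : 0 ≤ R := (abs_nonneg _).trans (hb 0)
  set D : ℝ := 2 * Real.exp (R ^ 2) + 4 * R ^ 4 * Real.exp (R ^ 2) + 2 * R ^ 2 with hD
  have hD0 : 0 ≤ D := by positivity
  have hprod : ∀ x y, |g x * g y| ≤ R ^ 2 := fun x y => by
    rw [abs_mul, sq]; exact mul_le_mul (hb x) (hb y) (abs_nonneg _) hR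
  rcases lt_or_ge (1 / 2) |ρ| with hρ | hρ
  -- For large correlation the expansion is unavailable, but `ρ²` is bounded below and the trivial
  -- bound `R²` suffices. This produces the `4` in the constant.
  · have h4 : 1 ≤ 4 * ρ ^ 2 := by rw [← sq_abs ρ]; nlinarith
    calc _ ≤ R ^ 2 := abs_integral_le_of_bounded fun p => hprod _ _
      _ ≤ R ^ 2 * (4 * ρ ^ 2) := le_mul_of_one_le_right (sq_nonneg R) h4
      _ ≤ R ^ 2 * (4 + D) * ρ ^ 2 := by
        rw [mul_assoc]; gcongr; linarith
  · have hρ2 : ρ ^ 2 < 1 := by rw [← sq_abs ρ]; nlinarith [abs_nonneg ρ]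
    have hint : Integrable (fun p : ℝ × ℝ =>
        g p.1 * g (ρ * p.1 + Real.sqrt (1 - ρ ^ 2) * p.2))
        ((gaussianReal 0 1).prod (gaussianReal 0 1)) :=
      integrable_of_measurable_of_bounded (by fun_prop) fun p => hprod _ _
    rw [integral_prod _ hint]
    have hinner : ∀ u, |∫ w, g u * g (ρ * u + Real.sqrt (1 - ρ ^ 2) * w) ∂(gaussianReal 0 1)| ≤
        R ^ 2 * D * ρ ^ 2 := by
      intro u
      rw [integral_const_mul, integral_comp_correlated_eq hg hρ2]
      rcases lt_or_ge R |u| with hu | hu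
      · rw [hsupp u hu]; simp; positivity
      · have hptw : ∀ x, |(mehlerKernel ρ u x - 1 - ρ * u * x) * g x| ≤ D * ρ ^ 2 * R := by
          intro x
          rcases lt_or_ge R |x| with hx | hx
          · rw [hsupp x hx]; simp; positivity
          · rw [abs_mul]
            exact mul_le_mul (abs_mehlerKernel_sub_le hρ hu hx) (hb x) (abs_nonneg _)
              (by positivity)
        have hgi : Integrable g (gaussianReal 0 1) := integrable_of_measurable_of_bounded hg hb
        have hxg : Integrable (fun x => x * g x) (gaussianReal 0 1) := by
          refine integrable_of_measurable_of_bounded (R := R * R) (by fun_prop) fun x => ?_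
          rcases lt_or_ge R |x| with hx | hx
          · rw [hsupp x hx]; simp; positivity
          · rw [abs_mul]; exact mul_le_mul hx (hb x) (abs_nonneg _) hR
        have hki : Integrable (fun x => (mehlerKernel ρ u x - 1 - ρ * u * x) * g x)
            (gaussianReal 0 1) := by
          have := measurable_mehlerKernel ρ u
          exact integrable_of_measurable_of_bounded (by fun_prop) hptw
        have heq : ∫ x, mehlerKernel ρ u x * g x ∂(gaussianReal 0 1) =
            ∫ x, (mehlerKernel ρ u x - 1 - ρ * u * x) * g x ∂(gaussianReal 0 1) := by
          have h2 : (fun x => mehlerKernel ρ u x * g x) = fun x =>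
              (mehlerKernel ρ u x - 1 - ρ * u * x) * g x + (g x + (ρ * u) * (x * g x)) := by
            ext x; ring
          have hsum : Integrable (fun x => g x + (ρ * u) * (x * g x)) (gaussianReal 0 1) :=
            hgi.add (hxg.const_mul _)
          rw [h2, integral_add hki hsum,
            integral_add hgi (hxg.const_mul _), integral_const_mul, h0, h1]
          simp
        rw [heq, abs_mul]
        calc |g u| * |∫ x, (mehlerKernel ρ u x - 1 - ρ * u * x) * g x ∂(gaussianReal 0 1)|
            ≤ R * (D * ρ ^ 2 * R) :=
              mul_le_mul (hb u) (abs_integral_le_of_bounded hptw) (abs_nonneg _) hR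
          _ = R ^ 2 * D * ρ ^ 2 := by ring
    calc _ ≤ R ^ 2 * D * ρ ^ 2 := abs_integral_le_of_bounded hinner
      _ ≤ _ := by gcongr; linarith

/-! ### Construction of the perturbation `g`. -/

/-- A bounded, compactly supported perturbation of the identity, close to it in `L¹` of the standard
Gaussian, and orthogonal to all affine functions. -/
lemma exists_bounded_orthogonal_approx {τ : ℝ} (hτ : 0 < τ) :
    ∃ g : ℝ → ℝ, ∃ R : ℝ, 0 < R ∧ Measurable g ∧ (∀ x, |g x| ≤ R) ∧
      (∀ x, R < |x| → g x = 0) ∧ ∫ x, g x ∂(gaussianReal 0 1) = 0 ∧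
      ∫ x, x * g x ∂(gaussianReal 0 1) = 0 ∧ ∫ x, |x - g x| ∂(gaussianReal 0 1) ≤ τ := by
  set M : ℝ := 2 / τ with hM
  have hM0 : 0 < M := by positivity
  set I : Set ℝ := {x | |x| ≤ M} with hI
  set J : Set ℝ := {x | M < |x| ∧ |x| ≤ M + 1} with hJ
  have hIm : MeasurableSet I := measurableSet_le (by fun_prop) (by fun_prop)
  have hJm : MeasurableSet J :=
    (measurableSet_lt (f := fun _ : ℝ => M) (g := fun x => |x|) (by fun_prop) (by fun_prop)).inter
      (measurableSet_le (f := fun x : ℝ => |x|) (g := fun _ => M + 1) (by fun_prop) (by fun_prop))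
  have hsq : Integrable (fun x : ℝ => x ^ 2) (gaussianReal 0 1) := integrable_pow_gaussianReal 2
  have hsq1 : ∫ x : ℝ, x ^ 2 ∂(gaussianReal 0 1) = 1 := integral_sq_gaussianReal
  set A : ℝ := ∫ x in I, x ^ 2 ∂(gaussianReal 0 1) with hA
  set S : ℝ := ∫ x in J, x ^ 2 ∂(gaussianReal 0 1) with hS
  have hA0 : 0 ≤ A := integral_nonneg fun x => sq_nonneg x
  have hA1 : A ≤ 1 := hsq1 ▸ setIntegral_le_integral hsq (ae_of_all _ fun x => sq_nonneg x)
  have hS0 : 0 < S := by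
    rw [hS, setIntegral_pos_iff_support_of_nonneg_ae (ae_of_all _ fun x => sq_nonneg x)
      hsq.integrableOn]
    -- The shell contains an interval, which has positive Gaussian mass because Lebesgue measure is
    -- absolutely continuous with respect to the Gaussian.
    have hsub : Set.Ioo M (M + 1) ⊆ (Function.support fun x : ℝ => x ^ 2) ∩ J := by
      intro x hx
      have hx0 : 0 < x := hM0.trans hx.1
      refine ⟨by simpa using hx0.ne', ?_⟩
      have hxJ : M < |x| ∧ |x| ≤ M + 1 := by
        rw [abs_of_pos hx0]; exact ⟨hx.1, hx.2.le⟩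
      exact hxJ
    refine lt_of_lt_of_le (pos_iff_ne_zero.2 fun h => ?_) (measure_mono hsub)
    have := gaussianReal_absolutelyContinuous' 0 (one_ne_zero (α := NNReal)) h
    simp at this
  -- The function is `x` on `I`, `-b x` on the shell `J`, and `0` beyond. This `b` makes the second
  -- moments over `I` and `J` cancel; being odd takes care of orthogonality to constants.
  set b : ℝ := A / S with hb
  have hb0 : 0 ≤ b := by positivity
  have hbS : b * S = A := by rw [hb]; field_simp
  let h : ℝ → ℝ := fun x => I.indicator 1 x - b * J.indicator 1 x
  have hhm : Measurable h :=
    (measurable_one.indicator hIm).sub ((measurable_one.indicator hJm).const_mul b)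
  have hIJ : ∀ x, x ∈ I → x ∉ J := fun x hx hx' => absurd hx'.1 (not_lt.2 hx)
  have hcase : ∀ x, (|x| ≤ M ∧ h x = 1) ∨ (M < |x| ∧ |x| ≤ M + 1 ∧ h x = -b) ∨
      (M + 1 < |x| ∧ h x = 0) := by
    intro x
    rcases le_or_gt |x| M with h1 | h1
    · refine Or.inl ⟨h1, ?_⟩
      have : x ∈ I := h1
      simp [h, this, hIJ x this]
    · have hxI : x ∉ I := not_le.2 h1
      rcases le_or_gt |x| (M + 1) with h2 | h2
      · refine Or.inr (Or.inl ⟨h1, h2, ?_⟩)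
        have : x ∈ J := ⟨h1, h2⟩
        simp [h, this, hxI]
      · refine Or.inr (Or.inr ⟨h2, ?_⟩)
        have : x ∉ J := fun hx => absurd hx.2 (not_le.2 h2)
        simp [h, this, hxI]
  have heven : ∀ x, h (-x) = h x := fun x => by
    simp [h, hI, hJ, Set.indicator, abs_neg]
  refine ⟨fun x => x * h x, (1 + b) * (M + 1), by positivity, by fun_prop, ?_, ?_, ?_, ?_, ?_⟩
  · intro x
    rw [abs_mul]
    rcases hcase x with ⟨h1, h2⟩ | ⟨h1, h2, h3⟩ | ⟨h1, h2⟩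
    · rw [h2, abs_one]; nlinarith
    · rw [h3, abs_neg, abs_of_nonneg hb0]; nlinarith [abs_nonneg x]
    · rw [h2, abs_zero, mul_zero]; positivity
  · intro x hx
    rcases hcase x with ⟨h1, h2⟩ | ⟨h1, h2, h3⟩ | ⟨h1, h2⟩
    · nlinarith
    · nlinarith
    · simp [h2]
  · have hneg : ∫ x, x * h x ∂(gaussianReal 0 1) = ∫ x, -(x * h x) ∂(gaussianReal 0 1) := by
      have hm := gaussianReal_map_neg (μ := 0) (v := 1)
      rw [neg_zero] at hm
      conv_lhs => rw [← hm]
      rw [integral_map (by fun_prop) (by fun_prop)]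
      simp [heven]
    rw [integral_neg] at hneg
    linarith
  · have h1 : (fun x => x * (x * h x)) =
        fun x => I.indicator (fun x => x ^ 2) x - b * J.indicator (fun x => x ^ 2) x := by
      ext x
      simp only [h, Set.indicator, Pi.one_apply]
      split_ifs <;> ring
    rw [h1, integral_sub (hsq.indicator hIm) ((hsq.indicator hJm).const_mul b),
      integral_const_mul, integral_indicator hIm, integral_indicator hJm, ← hA, ← hS, hbS, sub_self]
  -- The error lives where `|x| > M`, so `|x| ≤ x² / M` there. The correction on `J` contributes at
  -- most `b S / M = A / M`, which is why `M = 2 / τ` is enough.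
  · have hle : ∀ x, |x - x * h x| ≤ (x ^ 2 + b * J.indicator (fun x => x ^ 2) x) / M := by
      intro x
      rw [le_div_iff₀ hM0]
      have hx : x - x * h x = x * (1 - h x) := by ring
      rw [hx, abs_mul]
      have hJ0 : 0 ≤ J.indicator (fun x => x ^ 2) x :=
        Set.indicator_nonneg (fun x _ => sq_nonneg x) x
      rcases hcase x with ⟨h1, h2⟩ | ⟨h1, h2, h3⟩ | ⟨h1, h2⟩
      · rw [h2]; simp; positivity
      · have : x ∈ J := ⟨h1, h2⟩
        rw [h3, Set.indicator_of_mem this, sub_neg_eq_add,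
            abs_of_nonneg (by positivity : 0 ≤ 1 + b),
          ← sq_abs x]
        have : |x| * M ≤ |x| ^ 2 := by nlinarith [abs_nonneg x]
        nlinarith
      · rw [h2, sub_zero, abs_one, ← sq_abs x]
        nlinarith [abs_nonneg x, mul_nonneg hb0 hJ0]
    have hi2 : Integrable (fun x => (x ^ 2 + b * J.indicator (fun x => x ^ 2) x) / M)
        (gaussianReal 0 1) := (hsq.add ((hsq.indicator hJm).const_mul b)).div_const M
    calc ∫ x, |x - x * h x| ∂(gaussianReal 0 1)
        ≤ ∫ x, (x ^ 2 + b * J.indicator (fun x => x ^ 2) x) / M ∂(gaussianReal 0 1) :=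
          integral_mono_of_nonneg (ae_of_all _ fun x => abs_nonneg _) hi2 (ae_of_all _ hle)
      _ = (1 + A) / M := by
          rw [integral_div, integral_add hsq ((hsq.indicator hJm).const_mul b),
            integral_const_mul, integral_indicator hJm, hsq1, ← hS, hbS]
      _ ≤ 2 / M := by gcongr; linarith
      _ = τ := by rw [hM]; field_simp

/-! ### From total variation to corruption. -/

/-- The maximal coupling of two measures given by densities. -/
lemma exists_coupling_of_densities {S : Type*} [MeasurableSpace S] [MeasurableEq S]
    (μ : Measure S) {p q : S → ENNReal} (hp : Measurable p)
    (hq : Measurable q) (hp1 : ∫⁻ x, p x ∂μ = 1) (hq1 : ∫⁻ x, q x ∂μ = 1) :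
    ∃ π : Measure (S × S), π.map Prod.fst = μ.withDensity p ∧ π.map Prod.snd = μ.withDensity q ∧
      π {z | z.1 ≠ z.2} ≤ ∫⁻ x, (p x - q x) ∂μ := by
  set A : Measure S := μ.withDensity (fun x => p x - q x) with hA
  set B : Measure S := μ.withDensity (fun x => q x - p x) with hB
  set D : Measure S := μ.withDensity (fun x => min (p x) (q x)) with hD
  have hDA : A + D = μ.withDensity p := by
    rw [hA, hD, ← withDensity_add_right _ (hp.min hq)]
    congr 1; ext x; exact tsub_add_min
  have hDB : B + D = μ.withDensity q := by
    rw [hB, hD, ← withDensity_add_right _ (hp.min hq)]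
    congr 1; ext x; simp only [Pi.add_apply]; rw [min_comm]; exact tsub_add_min
  have hp2 : (μ.withDensity p) Set.univ = 1 := by simpa using hp1
  have hq2 : (μ.withDensity q) Set.univ = 1 := by simpa using hq1
  have hD1 : D Set.univ ≤ 1 := by
    rw [← hp2, ← hDA, Measure.add_apply]; exact le_add_self
  have hA1 : A Set.univ ≤ 1 := by
    rw [← hp2, ← hDA, Measure.add_apply]; exact le_self_add
  have hAB : A Set.univ = B Set.univ := by
    have h : A Set.univ + D Set.univ = B Set.univ + D Set.univ := by
      rw [← Measure.add_apply, ← Measure.add_apply, hDA, hDB, hp2, hq2]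
    exact (ENNReal.add_left_inj (hD1.trans_lt ENNReal.one_lt_top).ne).1 h
  have hAfin : IsFiniteMeasure A := ⟨hA1.trans_lt ENNReal.one_lt_top⟩
  have hBfin : IsFiniteMeasure B := ⟨hAB ▸ hA1.trans_lt ENNReal.one_lt_top⟩
  set t : ENNReal := A Set.univ with ht
  have ht' : t ≠ ⊤ := (hA1.trans_lt ENNReal.one_lt_top).ne
  -- The case `t = 0` has `t⁻¹ = ⊤`; it is harmless because the residual measures then vanish.
  have hscale : ∀ M : Measure S, M Set.univ = t → t⁻¹ • (t • M) = M := by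
    intro M hM
    rcases eq_or_ne t 0 with h0 | h0
    · have : M = 0 := Measure.measure_univ_eq_zero.1 (hM.trans h0)
      simp [this]
    · rw [smul_smul, ENNReal.inv_mul_cancel h0 ht', one_smul]
  refine ⟨t⁻¹ • A.prod B + D.map (fun x => (x, x)), ?_, ?_, ?_⟩
  · rw [Measure.map_add _ _ measurable_fst, Measure.map_smul, Measure.map_fst_prod, ← hAB,
      hscale A rfl, Measure.map_map measurable_fst (by fun_prop), ← hDA]
    congr 1
    exact Measure.map_id
  · rw [Measure.map_add _ _ measurable_snd, Measure.map_smul, Measure.map_snd_prod,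
      hscale B hAB.symm, Measure.map_map measurable_snd (by fun_prop), ← hDB]
    congr 1
    exact Measure.map_id
  · have hm : MeasurableSet {z : S × S | z.1 ≠ z.2} :=
      (measurableSet_diagonal (α := S)).compl
    rw [Measure.add_apply, Measure.map_apply (by fun_prop) hm]
    have h0 : (fun x : S => (x, x)) ⁻¹' {z : S × S | z.1 ≠ z.2} = ∅ := by
      ext x; simp
    rw [h0, measure_empty, add_zero, Measure.smul_apply, smul_eq_mul]
    calc t⁻¹ * (A.prod B) {z : S × S | z.1 ≠ z.2} ≤ t⁻¹ * (t * t) := by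
          gcongr
          refine (measure_mono (Set.subset_univ _)).trans ?_
          rw [← Set.univ_prod_univ, Measure.prod_prod, ← hAB]
      _ ≤ t := by
          rw [← mul_assoc]
          exact mul_le_of_le_one_left zero_le (ENNReal.inv_mul_le_one t)
      _ = ∫⁻ x, (p x - q x) ∂μ := by rw [ht, hA]; simp

/-- A per-sample coupling which moves each sample with small probability yields a corruption. -/
lemma exists_isCorruptedLaw_of_coupling {S : Type*} [MeasurableSpace S] [MeasurableEq S]
    {P P' : Measure S} [IsProbabilityMeasure P] [IsProbabilityMeasure P'] (π : Measure (S × S))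
    (h1 : π.map Prod.fst = P) (h2 : π.map Prod.snd = P') {ε t : ℝ} (hε : 0 < ε)
    (hπ : π {z | z.1 ≠ z.2} ≤ ENNReal.ofReal t) (n : ℕ) :
    ∃ Q : Measure (Fin n → S), IsCorruptedLaw ε n P Q ∧
      ∀ f : (Fin n → S) → ENNReal, Measurable f → (∀ x, f x ≤ 1) →
        ∫⁻ x, f x ∂Q ≤ ∫⁻ x, f x ∂(Measure.pi fun _ => P') + ENNReal.ofReal (t / ε) := by
  classical
  have hπp : IsProbabilityMeasure π := by
    refine ⟨?_⟩
    have : (π.map Prod.fst) Set.univ = 1 := by rw [h1]; exact measure_univ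
    rwa [Measure.map_apply measurable_fst MeasurableSet.univ, Set.preimage_univ] at this
  set D : Set (S × S) := {z | z.1 ≠ z.2} with hD
  have hDm : MeasurableSet D := (measurableSet_diagonal (α := S)).compl
  set κ : Measure (Fin n → S × S) := Measure.pi fun _ => π with hκ
  -- The Hamming distance written as a sum of indicators, which makes the budget event visibly
  -- measurable.
  let N' : (Fin n → S) × (Fin n → S) → ENNReal := fun w => ∑ i, D.indicator 1 (w.1 i, w.2 i)
  have hNm' : Measurable N' :=
    Finset.measurable_sum _ fun i _ => (measurable_one.indicator hDm).comp (by fun_prop)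
  have hN' : ∀ w, N' w = ENNReal.ofReal (({i : Fin n | w.2 i ≠ w.1 i}.ncard : ℝ)) := by
    intro w
    have h3 : {i : Fin n | w.2 i ≠ w.1 i}.ncard = ∑ i, if w.2 i ≠ w.1 i then 1 else 0 := by
      rw [Set.ncard_eq_toFinset_card', Finset.sum_boole]
      simp
    rw [ENNReal.ofReal_natCast, h3, Nat.cast_sum]
    refine Finset.sum_congr rfl fun i _ => ?_
    by_cases hi : w.2 i = w.1 i
    · simp [hi, hD]
    · simp [hi, hD, Ne.symm hi]
  let N : (Fin n → S × S) → ENNReal := fun z => ∑ i, D.indicator 1 (z i)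
  have hNm : Measurable N :=
    Finset.measurable_sum _ fun i _ => (measurable_one.indicator hDm).comp (measurable_pi_apply i)
  have hNint : ∫⁻ z, N z ∂κ ≤ n * ENNReal.ofReal t := by
    have hsum := lintegral_finsetSum (μ := κ) (f := fun (i : Fin n) z => D.indicator 1 (z i))
      Finset.univ fun i _ => (measurable_one.indicator hDm).comp (measurable_pi_apply i)
    refine (le_of_eq hsum).trans ?_
    calc ∑ i, ∫⁻ z, D.indicator 1 (z i) ∂κ ≤ ∑ _i : Fin n, ENNReal.ofReal t := by
          gcongr with i
          have hmp := (measurePreserving_eval (fun _ : Fin n => π) i).lintegral_comp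
            (f := D.indicator 1) (measurable_one.indicator hDm)
          refine (le_of_eq hmp).trans ?_
          rwa [lintegral_indicator_one hDm]
      _ = _ := by simp
  set G : Set (Fin n → S × S) := {z | N z ≤ ENNReal.ofReal (ε * n)} with hG
  have hGm : MeasurableSet G := measurableSet_le hNm measurable_const
  -- Markov's inequality for the number of moved samples. For `n = 0` the threshold is `0`, but no
  -- sample can be moved.
  have hbad : κ Gᶜ ≤ ENNReal.ofReal (t / ε) := by
    rcases Nat.eq_zero_or_pos n with h0 | h0
    · have : Gᶜ = ∅ := by
        subst h0
        ext z; simp [hG, N]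
      simp [this]
    · have hn : (0 : ℝ) < n := by exact_mod_cast h0
      have hsub : Gᶜ ⊆ {z | ENNReal.ofReal (ε * n) ≤ N z} := fun z hz => (le_total (N z) _).resolve_left hz
      refine (measure_mono hsub).trans ?_
      have hmk := mul_meas_ge_le_lintegral (μ := κ) hNm (ENNReal.ofReal (ε * n))
      have hpos : ENNReal.ofReal (ε * n) ≠ 0 := by
        simpa using mul_pos hε hn
      have h3 : κ {z | ENNReal.ofReal (ε * n) ≤ N z} ≤
          (n * ENNReal.ofReal t) / ENNReal.ofReal (ε * n) := by
        rw [ENNReal.le_div_iff_mul_le (Or.inl hpos) (Or.inl ENNReal.ofReal_ne_top), mul_comm]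
        exact hmk.trans hNint
      refine h3.trans (le_of_eq ?_)
      rw [← ENNReal.ofReal_natCast, ← ENNReal.ofReal_mul hn.le,
        ← ENNReal.ofReal_div_of_pos (mul_pos hε hn)]
      congr 1
      field_simp
  -- The adversary outputs the coupled samples when this fits its budget and otherwise changes
  -- nothing, so the constraint holds surely.
  let F₂ : (Fin n → S × S) → (Fin n → S) := G.piecewise (fun z i => (z i).2) (fun z i => (z i).1)
  have hF₂ : Measurable F₂ := Measurable.piecewise hGm (by fun_prop) (by fun_prop)
  let F : (Fin n → S × S) → (Fin n → S) × (Fin n → S) := fun z => (fun i => (z i).1, F₂ z)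
  have hF : Measurable F := Measurable.prodMk (by fun_prop) hF₂
  have hm1 : κ.map (fun z i => (z i).1) = Measure.pi fun _ => P := by
    have := Measure.pi_map_pi (μ := fun _ : Fin n => π) (f := fun _ => Prod.fst)
      (hμ := fun _ => by rw [h1]; infer_instance) (fun _ => measurable_fst.aemeasurable)
    rw [hκ, this, h1]
  have hm2 : κ.map (fun z i => (z i).2) = Measure.pi fun _ => P' := by
    have := Measure.pi_map_pi (μ := fun _ : Fin n => π) (f := fun _ => Prod.snd)
      (hμ := fun _ => by rw [h2]; infer_instance) (fun _ => measurable_snd.aemeasurable)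
    rw [hκ, this, h2]
  refine ⟨κ.map F₂, ⟨κ.map F, ?_, ?_, ?_⟩, ?_⟩
  · rw [Measure.map_map measurable_fst hF]; exact hm1
  · rw [Measure.map_map measurable_snd hF]; rfl
  · have hset : {w : (Fin n → S) × (Fin n → S) | ({i : Fin n | w.2 i ≠ w.1 i}.ncard : ℝ) ≤ ε * n} =
        {w | N' w ≤ ENNReal.ofReal (ε * n)} := by
      ext w
      simp only [Set.mem_ofPred_eq]
      rw [hN', ENNReal.ofReal_le_ofReal_iff (by positivity)]
    rw [ae_map_iff hF.aemeasurable (by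
      rw [hset]; exact measurableSet_le hNm' measurable_const)]
    refine ae_of_all _ fun z => ?_
    by_cases hz : z ∈ G
    · have h3 : F z ∈ {w | N' w ≤ ENNReal.ofReal (ε * n)} := by
        change N' (F z) ≤ _
        have : N' (F z) = N z := by simp [F, F₂, hz, N, N']
        rw [this]; exact hz
      rw [← hset] at h3
      exact h3
    · simp only [F, F₂, hz, not_false_iff, Set.piecewise_eq_of_notMem, ne_eq, not_true_eq_false]
      simp
      positivity
  · intro f hf hf1
    rw [lintegral_map hf hF₂, ← hm2, lintegral_map hf (by fun_prop)]
    calc ∫⁻ z, f (F₂ z) ∂κ ≤ ∫⁻ z, (f (fun i => (z i).2) + Gᶜ.indicator 1 z) ∂κ := by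
          refine lintegral_mono fun z => ?_
          by_cases hz : z ∈ G
          · simp [F₂, hz]
          · simp only [F₂, hz, not_false_iff, Set.piecewise_eq_of_notMem, Set.mem_compl_iff,
              Set.indicator_of_mem, Pi.one_apply]
            exact (hf1 _).trans le_add_self
      _ = ∫⁻ z, f (fun i => (z i).2) ∂κ + κ Gᶜ := by
          rw [lintegral_add_left (by fun_prop), lintegral_indicator_one hGm.compl]
      _ ≤ _ := by gcongr

/-! ### Product densities and the second moment method. -/

lemma pi_withDensity_eq {ι S : Type*} [Fintype ι] [MeasurableSpace S] (μ : Measure S)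
    [IsProbabilityMeasure μ] {q : S → ENNReal} (hq : Measurable q)
    [SigmaFinite (μ.withDensity q)] :
    Measure.pi (fun _ : ι => μ.withDensity q) =
      (Measure.pi (fun _ : ι => μ)).withDensity (fun x => ∏ i, q (x i)) := by
  refine Measure.pi_eq fun s hs => ?_
  have hbox : MeasurableSet (Set.univ.pi s) := MeasurableSet.univ_pi hs
  have hm : ∀ i, Measurable ((s i).indicator q) := fun i => hq.indicator (hs i)
  rw [withDensity_apply _ hbox, ← lintegral_indicator hbox]
  have h1 : ∀ x : ι → S, (Set.univ.pi s).indicator (fun x => ∏ i, q (x i)) x =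
      ∏ i, (s i).indicator q (x i) := by
    intro x
    by_cases hx : x ∈ Set.univ.pi s
    · rw [Set.indicator_of_mem hx]
      exact Finset.prod_congr rfl fun i _ => (Set.indicator_of_mem (hx i (Set.mem_univ i)) q).symm
    · rw [Set.indicator_of_notMem hx]
      have : ∃ i, x i ∉ s i := by simpa using hx
      obtain ⟨i, hi⟩ := this
      exact (Finset.prod_eq_zero (Finset.mem_univ i) (Set.indicator_of_notMem hi q)).symm
  simp_rw [h1]
  have hind := iIndepFun_pi (μ := fun _ : ι => μ) (X := fun i => (s i).indicator q)
    fun i => (hm i).aemeasurable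
  rw [lintegral_prod_eq_prod_lintegral_of_indepFun Finset.univ _ hind
    fun i => (hm i).comp (measurable_pi_apply i)]
  refine Finset.prod_congr rfl fun i _ => ?_
  rw [withDensity_apply _ (hs i), ← lintegral_indicator (hs i)]
  exact (measurePreserving_eval (fun _ : ι => μ) i).lintegral_comp (hm i)

/-- The second moment method for mixtures of product densities. -/
lemma average_integral_prod_sub_le {S V : Type*} [MeasurableSpace S] [Fintype V] [Nonempty V]
    (μ : Measure S) [IsProbabilityMeasure μ] {q : V → S → ℝ} (hq : ∀ v, Measurable (q v))
    {R : ℝ} (hb : ∀ v x, |q v x| ≤ R) (h1 : ∀ v, ∫ x, q v x ∂μ = 1) (n : ℕ) {η : ℝ} (hη : 0 < η)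
    (h2 : ∑ v, ∑ w, (∫ x, q v x * q w x ∂μ) ^ n ≤ (1 + η ^ 2) * (Fintype.card V : ℝ) ^ 2)
    {f : (Fin n → S) → ℝ} (hf : Measurable f) (hf1 : ∀ x, |f x| ≤ 1) :
    (∑ v, ∫ x, f x * ∏ i, q v (x i) ∂(Measure.pi fun _ => μ)) / Fintype.card V
      - ∫ x, f x ∂(Measure.pi fun _ => μ) ≤ η := by
  set κ : Measure (Fin n → S) := Measure.pi fun _ => μ with hκ
  set c : ℝ := (Fintype.card V : ℝ) with hc
  have hc0 : 0 < c := by rw [hc]; exact_mod_cast Fintype.card_pos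
  let Q : V → (Fin n → S) → ℝ := fun v x => ∏ i, q v (x i)
  have hQm : ∀ v, Measurable (Q v) := fun v =>
    Finset.measurable_prod _ fun i _ => (hq v).comp (measurable_pi_apply i)
  have hQb : ∀ v x, |Q v x| ≤ R ^ n := fun v x => by
    rw [Finset.abs_prod]
    calc ∏ i, |q v (x i)| ≤ ∏ _i : Fin n, R :=
          Finset.prod_le_prod (fun _ _ => abs_nonneg _) fun i _ => hb v _
      _ = R ^ n := by simp
  have hQi : ∀ v, Integrable (Q v) κ := fun v => integrable_of_measurable_of_bounded (hQm v) (hQb v)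
  have hQQi : ∀ v w, Integrable (fun x => Q v x * Q w x) κ := fun v w =>
    integrable_of_measurable_of_bounded (R := R ^ n * R ^ n) ((hQm v).mul (hQm w)) fun x => by
      rw [abs_mul]
      exact mul_le_mul (hQb v x) (hQb w x) (abs_nonneg _) ((abs_nonneg _).trans (hQb v x))
  have hfQi : ∀ v, Integrable (fun x => f x * Q v x) κ := fun v =>
    integrable_of_measurable_of_bounded (R := 1 * R ^ n) (hf.mul (hQm v)) fun x => by
      rw [abs_mul]
      exact mul_le_mul (hf1 x) (hQb v x) (abs_nonneg _) zero_le_one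
  have hfi : Integrable f κ := integrable_of_measurable_of_bounded hf hf1
  have hQ1 : ∀ v, ∫ x, Q v x ∂κ = 1 := fun v => by
    have := integral_fintype_prod_eq_pow (ι := Fin n) (q v) (μ := μ)
    rw [h1 v, one_pow] at this
    exact this
  have hQQ : ∀ v w, ∫ x, Q v x * Q w x ∂κ = (∫ x, q v x * q w x ∂μ) ^ n := fun v w => by
    have := integral_fintype_prod_eq_pow (ι := Fin n) (fun x => q v x * q w x) (μ := μ)
    rw [Fintype.card_fin] at this
    rw [← this]
    simp only [Q, Finset.prod_mul_distrib, hκ]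
  let L : (Fin n → S) → ℝ := fun x => (∑ v, Q v x) / c
  have hLi : Integrable L κ := (integrable_finsetSum _ fun v _ => hQi v).div_const c
  have hL1 : ∫ x, L x ∂κ = 1 := by
    simp only [L]
    rw [integral_div, integral_finsetSum _ fun v _ => hQi v]
    simp only [hQ1, Finset.sum_const, Finset.card_univ, nsmul_eq_mul, mul_one, ← hc]
    exact div_self hc0.ne'
  have hL2 : (fun x => L x ^ 2) = fun x => (∑ v, ∑ w, Q v x * Q w x) / c ^ 2 := by
    ext x; simp only [L]; rw [div_pow, sq (∑ v, Q v x), Finset.sum_mul_sum]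
  have hss : Integrable (fun x => ∑ v, ∑ w, Q v x * Q w x) κ :=
    integrable_finsetSum _ fun v _ => integrable_finsetSum _ fun w _ => hQQi v w
  have hL2i : Integrable (fun x => L x ^ 2) κ := by
    rw [hL2]; exact hss.div_const _
  have hL2le : ∫ x, L x ^ 2 ∂κ ≤ 1 + η ^ 2 := by
    rw [hL2, integral_div, integral_finsetSum _ fun v _ => integrable_finsetSum _ fun w _ => hQQi v w]
    simp_rw [integral_finsetSum _ fun w _ => hQQi _ w, hQQ]
    rw [div_le_iff₀ (by positivity)]
    exact h2
  have hfL : (fun x => f x * (L x - 1)) = fun x => (∑ v, f x * Q v x) / c - f x := by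
    ext x
    simp only [L, ← Finset.mul_sum]
    ring
  have hfsi : Integrable (fun x => (∑ v, f x * Q v x) / c) κ :=
    (integrable_finsetSum _ fun v _ => hfQi v).div_const c
  have hfLi : Integrable (fun x => f x * (L x - 1)) κ := by
    rw [hfL]; exact hfsi.sub hfi
  have hlhs : (∑ v, ∫ x, f x * ∏ i, q v (x i) ∂κ) / c - ∫ x, f x ∂κ =
      ∫ x, f x * (L x - 1) ∂κ := by
    rw [hfL, integral_sub hfsi hfi, integral_div, integral_finsetSum _ fun v _ => hfQi v]
  rw [hlhs]
  have hbi : Integrable (fun x => (L x ^ 2 - 2 * L x + 1) / (2 * η) + η / 2) κ :=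
    (((hL2i.sub (hLi.const_mul 2)).add (integrable_const 1)).div_const _).add (integrable_const _)
  -- `|L - 1| ≤ (L - 1)² / (2η) + η / 2` replaces Cauchy–Schwarz; `∫ (L - 1)² ≤ η²` then gives
  -- exactly `η`.
  calc ∫ x, f x * (L x - 1) ∂κ ≤ ∫ x, (L x ^ 2 - 2 * L x + 1) / (2 * η) + η / 2 ∂κ := by
        refine integral_mono hfLi hbi fun x => ?_
        have h3 : f x * (L x - 1) ≤ |L x - 1| := by
          calc f x * (L x - 1) ≤ |f x * (L x - 1)| := le_abs_self _
            _ = |f x| * |L x - 1| := abs_mul _ _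
            _ ≤ 1 * |L x - 1| := by gcongr; exact hf1 x
            _ = |L x - 1| := one_mul _
        have h4 : |L x - 1| ≤ (L x ^ 2 - 2 * L x + 1) / (2 * η) + η / 2 := by
          have h5 : L x ^ 2 - 2 * L x + 1 = |L x - 1| ^ 2 := by rw [sq_abs]; ring
          rw [h5, div_add_div _ _ (by positivity) two_ne_zero, le_div_iff₀ (by positivity)]
          nlinarith [sq_nonneg (|L x - 1| - η)]
        exact h3.trans h4
    _ = ((∫ x, L x ^ 2 ∂κ) - 2 * 1 + 1) / (2 * η) + η / 2 := by
        have e1 : Integrable (fun x => L x ^ 2 - 2 * L x) κ := hL2i.sub (hLi.const_mul 2)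
        have e2 : Integrable (fun x => (L x ^ 2 - 2 * L x + 1) / (2 * η)) κ :=
          (e1.add (integrable_const 1)).div_const _
        rw [integral_add e2 (integrable_const _), integral_div, integral_add e1 (integrable_const 1),
          integral_sub hL2i (hLi.const_mul 2), integral_const_mul, hL1]
        simp
    _ ≤ (1 + η ^ 2 - 2 * 1 + 1) / (2 * η) + η / 2 := by gcongr
    _ = η := by field_simp; ring

/-! ### Exponential moments of the overlap. -/

/-- The sign encoded by a bit. -/
def boolSign (b : Bool) : ℝ := if b then 1 else -1

lemma boolSign_not (b : Bool) : boolSign (!b) = -boolSign b := by cases b <;> simp [boolSign]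

lemma boolSign_mul_self (b : Bool) : boolSign b * boolSign b = 1 := by cases b <;> simp [boolSign]

lemma abs_boolSign (b : Bool) : |boolSign b| = 1 := by cases b <;> simp [boolSign]

/-- Square-exponential moment of a Rademacher sum. -/
lemma sum_exp_sq_rademacher_le {ι : Type*} [Fintype ι] [DecidableEq ι] (τ : ι → Bool)
    (A : Finset ι) : ∀ t : ℝ, 0 ≤ t → 4 * t * A.card ≤ 1 →
      ∑ σ : ι → Bool, Real.exp (t * (∑ i ∈ A, boolSign (σ i) * boolSign (τ i)) ^ 2) ≤
        2 ^ Fintype.card ι * Real.exp (2 * t * A.card) := by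
  induction A using Finset.induction_on with
  | empty => intro t _ _; simp
  | insert a A ha ih =>
    intro t ht hA
    rw [Finset.card_insert_of_notMem ha] at hA ⊢
    push_cast at hA ⊢
    set N : ℝ := (A.card : ℝ) with hN
    have hN0 : 0 ≤ N := by positivity
    let T : (ι → Bool) → ℝ := fun σ => ∑ i ∈ A, boolSign (σ i) * boolSign (τ i)
    -- Pairing `σ` with its flip at `a` averages out one sign. The resulting `cosh` is at most `exp
    -- (2 t² T²)`, so the exponent passes from `t` to `t + 2 t²`; hence `t` is kept general in the
    -- induction.
    let flip : (ι → Bool) → (ι → Bool) := fun σ => Function.update σ a (!σ a)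
    have hflip : Function.Involutive flip := fun σ => by
      ext i
      by_cases hi : i = a
      · subst hi; simp [flip]
      · simp [flip, hi]
    have hT : ∀ σ, T (flip σ) = T σ := fun σ => by
      refine Finset.sum_congr rfl fun i hi => ?_
      have : i ≠ a := fun h => ha (h ▸ hi)
      simp [flip, this]
    let F : (ι → Bool) → ℝ := fun σ =>
      Real.exp (t * (boolSign (σ a) * boolSign (τ a) + T σ) ^ 2)
    have hpair : ∀ σ, F σ + F (flip σ) ≤ 2 * (Real.exp t * Real.exp ((t + 2 * t ^ 2) * T σ ^ 2)) := by
      intro σ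
      have hfa : boolSign (flip σ a) = -boolSign (σ a) := by simp [flip, boolSign_not]
      simp only [F, hT, hfa]
      set x : ℝ := boolSign (σ a) * boolSign (τ a) with hx
      have hx2 : x ^ 2 = 1 := by
        rw [hx, mul_pow, sq, sq, boolSign_mul_self, boolSign_mul_self, one_mul]
      have h1 : t * (x + T σ) ^ 2 = t + t * T σ ^ 2 + 2 * t * (x * T σ) := by
        rw [add_sq, hx2]; ring
      have h2 : t * (-boolSign (σ a) * boolSign (τ a) + T σ) ^ 2 =
          t + t * T σ ^ 2 + -(2 * t * (x * T σ)) := by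
        rw [neg_mul, ← hx, add_sq, neg_sq, hx2]; ring
      rw [h1, h2, Real.exp_add (t + t * T σ ^ 2), Real.exp_add (t + t * T σ ^ 2), ← mul_add]
      have h3 : Real.exp (2 * t * (x * T σ)) + Real.exp (-(2 * t * (x * T σ))) ≤
          2 * Real.exp (2 * t ^ 2 * T σ ^ 2) := by
        have := Real.cosh_le_exp_half_sq (2 * t * (x * T σ))
        rw [Real.cosh_eq] at this
        have h4 : (2 * t * (x * T σ)) ^ 2 / 2 = 2 * t ^ 2 * T σ ^ 2 := by
          rw [mul_pow, mul_pow x, hx2]; ring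
        rw [h4] at this
        linarith
      calc _ ≤ Real.exp (t + t * T σ ^ 2) * (2 * Real.exp (2 * t ^ 2 * T σ ^ 2)) := by gcongr
        _ = _ := by
          rw [mul_left_comm, ← Real.exp_add, ← Real.exp_add]; congr 2; ring
    have hsum : ∑ σ, F σ = ∑ σ, F (flip σ) :=
      (Equiv.sum_comp hflip.toPerm F).symm
    have hdouble : ∑ σ, F σ ≤ Real.exp t * ∑ σ, Real.exp ((t + 2 * t ^ 2) * T σ ^ 2) := by
      have h5 : ∑ σ, (F σ + F (flip σ)) ≤
          ∑ σ, 2 * (Real.exp t * Real.exp ((t + 2 * t ^ 2) * T σ ^ 2)) :=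
        Finset.sum_le_sum fun σ _ => hpair σ
      rw [Finset.sum_add_distrib, ← hsum, ← Finset.mul_sum, ← Finset.mul_sum] at h5
      linarith
    have hrw : ∀ σ : ι → Bool, ∑ i ∈ insert a A, boolSign (σ i) * boolSign (τ i) =
        boolSign (σ a) * boolSign (τ a) + T σ := fun σ => Finset.sum_insert ha
    simp_rw [hrw]
    -- The hypothesis for one more element leaves slack `4 t`, while the increase `8 t² N` is at
    -- most `2 t`.
    have hcond : 4 * (t + 2 * t ^ 2) * N ≤ 1 := by nlinarith [mul_nonneg ht hN0]
    refine hdouble.trans ?_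
    calc Real.exp t * ∑ σ, Real.exp ((t + 2 * t ^ 2) * T σ ^ 2)
        ≤ Real.exp t * (2 ^ Fintype.card ι * Real.exp (2 * (t + 2 * t ^ 2) * N)) := by
          gcongr; exact ih _ (by positivity) hcond
      _ = 2 ^ Fintype.card ι * Real.exp (t + 2 * (t + 2 * t ^ 2) * N) := by
          rw [Real.exp_add]; ring
      _ ≤ _ := by
          gcongr
          nlinarith [mul_nonneg ht hN0]

/-- Exponential moment of the number of coincidences with a fixed function. -/
lemma sum_exp_coincidences_le {ι : Type*} [Fintype ι] [DecidableEq ι] {B : ℕ} (hB : 0 < B)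
    (j' : ι → Fin B) (a : ℝ) :
    ∑ j : ι → Fin B, Real.exp (a * (Finset.univ.filter fun i => j i = j' i).card) ≤
      B ^ Fintype.card ι * Real.exp (Fintype.card ι * ((Real.exp a - 1) / B)) := by
  have hB' : (0 : ℝ) < B := by exact_mod_cast hB
  have h1 : ∀ j : ι → Fin B, Real.exp (a * (Finset.univ.filter fun i => j i = j' i).card) =
      ∏ i, (if j i = j' i then Real.exp a else 1) := by
    intro j
    rw [Finset.prod_ite, Finset.prod_const, Finset.prod_const_one, mul_one, ← Real.exp_nat_mul]
    ring_nf
  simp_rw [h1]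
  have h2 := Finset.prod_univ_sum (fun _ : ι => (Finset.univ : Finset (Fin B)))
    (fun i b => if b = j' i then Real.exp a else (1 : ℝ))
  rw [Fintype.piFinset_univ] at h2
  rw [← h2]
  have h3 : ∀ i, ∑ b : Fin B, (if b = j' i then Real.exp a else (1 : ℝ)) =
      B * ((Real.exp a - 1) / B + 1) := by
    intro i
    have : ∀ b : Fin B, (if b = j' i then Real.exp a else (1 : ℝ)) =
        (if b = j' i then Real.exp a - 1 else 0) + 1 := fun b => by split_ifs <;> ring
    simp_rw [this, Finset.sum_add_distrib]
    simp
    field_simp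
  simp_rw [h3]
  rw [Finset.prod_const, Finset.card_univ, mul_pow, Real.exp_nat_mul]
  have h4 : 0 ≤ (Real.exp a - 1) / B + 1 := by
    have : (Real.exp a - 1) / B + 1 = (Real.exp a + (B - 1)) / B := by field_simp; ring
    rw [this]
    have hB1 : (1 : ℝ) ≤ B := by exact_mod_cast hB
    have := Real.exp_pos a
    apply div_nonneg _ hB'.le
    linarith
  gcongr
  exact Real.add_one_le_exp _

/-- The overlap of two signed selections of one element per block. -/
def signedOverlap {k B : ℕ} (v w : (Fin k → Fin B) × (Fin k → Bool)) : ℝ :=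
  ∑ i, if v.1 i = w.1 i then boolSign (v.2 i) * boolSign (w.2 i) else 0

/-- Split by the number `N` of agreeing blocks. If `4 t N ≤ 1`, averaging over signs gives `exp (2 t
N)`. Otherwise `S² ≤ k N` for the overlap `S`, and the factor `exp (θ (N - 1 / (4 t))) ≥ 1` is
inserted as a Chernoff tilt. Both terms are then exponential moments of `N`. -/
lemma sum_exp_sq_signedOverlap_le {k B : ℕ} (hB : 0 < B)
    (w : (Fin k → Fin B) × (Fin k → Bool)) {t θ : ℝ} (ht : 0 < t) (hθ : 0 ≤ θ) :
    ∑ v : (Fin k → Fin B) × (Fin k → Bool), Real.exp (t * signedOverlap v w ^ 2) ≤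
      (Fintype.card ((Fin k → Fin B) × (Fin k → Bool)) : ℝ) *
        (Real.exp (k * ((Real.exp (2 * t) - 1) / B)) +
          Real.exp (k * ((Real.exp (t * k + θ) - 1) / B) - θ / (4 * t))) := by
  have hS : ∀ v, signedOverlap v w = ∑ i ∈ Finset.univ.filter (fun i => v.1 i = w.1 i),
      boolSign (v.2 i) * boolSign (w.2 i) := fun v => by
    rw [signedOverlap, Finset.sum_filter]
  rw [Fintype.sum_prod_type]
  have hinner : ∀ j : Fin k → Fin B, ∑ σ : Fin k → Bool, Real.exp (t * signedOverlap (j, σ) w ^ 2) ≤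
      2 ^ k * (Real.exp (2 * t * (Finset.univ.filter fun i => j i = w.1 i).card) +
        Real.exp ((t * k + θ) * (Finset.univ.filter fun i => j i = w.1 i).card) *
          Real.exp (-(θ / (4 * t)))) := by
    intro j
    set A := Finset.univ.filter fun i => j i = w.1 i with hA
    have hAk : (A.card : ℝ) ≤ k := by
      exact_mod_cast (Finset.card_le_univ A).trans_eq (Fintype.card_fin k)
    rcases le_or_gt (4 * t * A.card) 1 with h | h
    · have := sum_exp_sq_rademacher_le w.2 A t ht.le h
      rw [Fintype.card_fin] at this
      simp_rw [hS]
      refine this.trans ?_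
      gcongr
      exact le_add_of_nonneg_right (by positivity)
    · have hb : ∀ σ : Fin k → Bool, Real.exp (t * signedOverlap (j, σ) w ^ 2) ≤
          Real.exp ((t * k + θ) * A.card) * Real.exp (-(θ / (4 * t))) := by
        intro σ
        rw [← Real.exp_add]
        gcongr
        have h1 : |signedOverlap (j, σ) w| ≤ A.card := by
          rw [hS]
          refine (Finset.abs_sum_le_sum_abs _ _).trans ?_
          simp [abs_mul, abs_boolSign, hA]
        have h2 : signedOverlap (j, σ) w ^ 2 ≤ k * A.card := by
          rw [← sq_abs]
          nlinarith [abs_nonneg (signedOverlap (j, σ) w)]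
        have h3 : θ / (4 * t) ≤ θ * A.card := by
          rw [div_le_iff₀ (by positivity)]
          nlinarith [mul_le_mul_of_nonneg_left h.le hθ]
        nlinarith [mul_le_mul_of_nonneg_left h2 ht.le]
      calc _ ≤ ∑ _σ : Fin k → Bool, Real.exp ((t * k + θ) * A.card) * Real.exp (-(θ / (4 * t))) :=
            Finset.sum_le_sum fun σ _ => hb σ
        _ = 2 ^ k * (Real.exp ((t * k + θ) * A.card) * Real.exp (-(θ / (4 * t)))) := by simp
        _ ≤ _ := by
          gcongr
          exact le_add_of_nonneg_left (by positivity)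
  have h1 := sum_exp_coincidences_le hB w.1 (2 * t)
  have h2 := sum_exp_coincidences_le hB w.1 (t * k + θ)
  rw [Fintype.card_fin] at h1 h2
  calc _ ≤ ∑ j : Fin k → Fin B, 2 ^ k *
        (Real.exp (2 * t * (Finset.univ.filter fun i => j i = w.1 i).card) +
        Real.exp ((t * k + θ) * (Finset.univ.filter fun i => j i = w.1 i).card) *
          Real.exp (-(θ / (4 * t)))) := Finset.sum_le_sum fun j _ => hinner j
    _ ≤ 2 ^ k * (B ^ k * Real.exp (k * ((Real.exp (2 * t) - 1) / B)) +
        B ^ k * Real.exp (k * ((Real.exp (t * k + θ) - 1) / B)) * Real.exp (-(θ / (4 * t)))) := by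
        rw [← Finset.mul_sum, Finset.sum_add_distrib, ← Finset.sum_mul]
        gcongr
    _ = _ := by
        rw [sub_eq_add_neg (k * ((Real.exp (t * k + θ) - 1) / B) : ℝ),
          Real.exp_add _ (-(θ / (4 * t)))]
        simp only [Fintype.card_prod, Fintype.card_fun, Fintype.card_fin, Fintype.card_bool]
        push_cast
        ring

/-- If `t k` is at most a small multiple of `log d`, the square-exponential moment of the overlap
of two random `d ^ (1 - δ)`-sparse directions is close to `1`. -/
lemma sum_exp_sq_signedOverlap_le_of_sparse {δ : ℝ} (hδ : 0 < δ) (hδ1 : δ < 1) {d k B : ℕ}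
    (hd : 2 ≤ d) (hk : k = ⌊(d : ℝ) ^ (1 - δ)⌋₊) (hB : B = d / k)
    (w : (Fin k → Fin B) × (Fin k → Bool)) {t : ℝ}
    (ht : t * k ≤ δ * (1 - δ) / 512 * Real.log d) :
    ∑ v : (Fin k → Fin B) × (Fin k → Bool), Real.exp (t * signedOverlap v w ^ 2) ≤
      (Fintype.card ((Fin k → Fin B) × (Fin k → Bool)) : ℝ) * (1 + (1 / 4) ^ 2) := by
  set c : ℝ := δ * (1 - δ) / 512 with hc
  have hδ' : 0 < 1 - δ := by linarith
  have hc0 : 0 < c := by positivity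
  have hd1 : (1 : ℝ) < d := by exact_mod_cast hd
  have hd0 : (0 : ℝ) < d := by linarith
  have hlog : 0 < Real.log d := Real.log_pos hd1
  set s : ℝ := (d : ℝ) ^ (1 - δ) with hs
  set r : ℝ := (d : ℝ) ^ δ with hr
  have hr0 : 0 < r := Real.rpow_pos_of_pos hd0 _
  have hsr : s * r = d := by
    rw [hs, hr, ← Real.rpow_add hd0]; simp
  have hs1 : 1 ≤ s := Real.one_le_rpow hd1.le hδ'.le
  have hsd : s ≤ d := by
    have := Real.one_le_rpow hd1.le hδ.le
    nlinarith
  have hk1 : 1 ≤ k := by rw [hk]; exact (Nat.one_le_floor_iff s).2 hs1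
  have hk1' : (1 : ℝ) ≤ k := by exact_mod_cast hk1
  have hks : (k : ℝ) ≤ s := by rw [hk]; exact Nat.floor_le (by linarith)
  have hks2 : s ≤ 2 * k := by
    have := Nat.lt_floor_add_one s
    rw [← hk] at this
    linarith
  have hkd : k ≤ d := by exact_mod_cast hks.trans hsd
  have hB1 : 1 ≤ B := by rw [hB]; exact (Nat.one_le_div_iff (by omega)).2 hkd
  have hB0 : (0 : ℝ) < B := by exact_mod_cast hB1
  -- Rounding in the quotient loses a factor of at most two: `d < (B + 1) k ≤ 2 B s`.
  have hBr : r ≤ 2 * B := by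
    have h1 : d < (B + 1) * k := by
      rw [hB, mul_comm]; exact Nat.lt_mul_div_succ d (by omega)
    have h2 : (d : ℝ) < (B + 1) * k := by exact_mod_cast h1
    have hB1' : (1 : ℝ) ≤ B := by exact_mod_cast hB1
    have h3 : s * r ≤ 2 * B * s := by
      rw [hsr]
      nlinarith
    nlinarith
  have hlr : Real.log d ≤ r / δ := Real.log_le_rpow_div hd0.le hδ
  have hls : Real.log d ≤ s / (1 - δ) := Real.log_le_rpow_div hd0.le hδ'
  -- The largest admissible `t`. Passing to it also covers `t ≤ 0`, which the two-term bound
  -- excludes.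
  set t₀ : ℝ := c * Real.log d / k with ht₀
  have ht0 : 0 < t₀ := by positivity
  have htk : t₀ * k = c * Real.log d := by rw [ht₀]; field_simp
  have htt : t ≤ t₀ := by rw [ht₀, le_div_iff₀ (by linarith)]; exact ht
  -- With this tilt `exp (t₀ k + θ)` stays below `d ^ δ`, comparable to the block size, while `θ /
  -- (4 t₀)` is at least `64 k`. The second term is therefore at most `exp (-62 k)`.
  set θ : ℝ := δ / 2 * Real.log d with hθ
  have hmain := sum_exp_sq_signedOverlap_le hB1 w ht0 (by positivity : 0 ≤ θ)
  have h1 : ∑ v : (Fin k → Fin B) × (Fin k → Bool), Real.exp (t * signedOverlap v w ^ 2) ≤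
      ∑ v : (Fin k → Fin B) × (Fin k → Bool), Real.exp (t₀ * signedOverlap v w ^ 2) := by
    gcongr
  refine (h1.trans hmain).trans (mul_le_mul_of_nonneg_left ?_ (Nat.cast_nonneg _))
  have hA : Real.exp (k * ((Real.exp (2 * t₀) - 1) / B)) ≤ 1 + 1 / 32 := by
    have h2 : 2 * t₀ ≤ 1 := by
      have : 2 * (c * Real.log d) ≤ 1 * k := by
        calc 2 * (c * Real.log d) ≤ 2 * (c * (s / (1 - δ))) := by gcongr
          _ = δ / 256 * s := by rw [hc]; field_simp; ring
          _ ≤ 1 / 256 * (2 * k) := by gcongr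
          _ ≤ 1 * k := by linarith
      rw [ht₀, ← mul_div_assoc, div_le_iff₀ (by linarith)]
      exact this
    have h3 : Real.exp (2 * t₀) - 1 ≤ 4 * t₀ := by
      have := Real.abs_exp_sub_one_le (x := 2 * t₀) (by rw [abs_of_pos (by linarith)]; exact h2)
      rw [abs_of_pos (by linarith : 0 < 2 * t₀)] at this
      linarith [le_abs_self (Real.exp (2 * t₀) - 1)]
    have h4 : k * ((Real.exp (2 * t₀) - 1) / B) ≤ 1 / 64 := by
      calc k * ((Real.exp (2 * t₀) - 1) / B) ≤ k * (4 * t₀ / B) := by gcongr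
        _ = 4 * (t₀ * k) / B := by ring
        _ = 4 * (c * Real.log d) / B := by rw [htk]
        _ ≤ 4 * (c * (r / δ)) / B := by gcongr
        _ = (1 - δ) / 128 * r / B := by rw [hc]; field_simp; ring
        _ ≤ 1 / 128 * (2 * B) / B := by gcongr; linarith
        _ = 1 / 64 := by field_simp; norm_num
    calc Real.exp (k * ((Real.exp (2 * t₀) - 1) / B)) ≤ Real.exp (1 / 64) := by gcongr
      _ ≤ 1 + 1 / 32 := by
        have := Real.abs_exp_sub_one_le (x := 1 / 64) (by norm_num [abs_of_pos])
        rw [abs_of_pos (by norm_num : (0 : ℝ) < 1 / 64)] at this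
        linarith [le_abs_self (Real.exp (1 / 64) - 1)]
  have hC : Real.exp (k * ((Real.exp (t₀ * k + θ) - 1) / B) - θ / (4 * t₀)) ≤ 1 / 32 := by
    have h2 : Real.exp (t₀ * k + θ) ≤ r := by
      rw [htk, hr, Real.rpow_def_of_pos hd0]
      gcongr
      rw [hθ, hc]
      nlinarith [mul_pos hδ hlog, mul_pos (mul_pos hδ hδ) hlog]
    have h3 : k * ((Real.exp (t₀ * k + θ) - 1) / B) ≤ 2 * k := by
      calc k * ((Real.exp (t₀ * k + θ) - 1) / B) ≤ k * (2 * B / B) := by gcongr; linarith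
        _ = 2 * k := by field_simp
    have h4 : 64 * (k : ℝ) ≤ θ / (4 * t₀) := by
      have : θ / (4 * t₀) = 64 / (1 - δ) * k := by
        rw [hθ, ht₀, hc]; field_simp; ring
      rw [this]
      gcongr
      rw [le_div_iff₀ hδ']; linarith
    have h5 : k * ((Real.exp (t₀ * k + θ) - 1) / B) - θ / (4 * t₀) ≤ -62 := by linarith
    calc _ ≤ Real.exp (-62) := by gcongr
      _ ≤ 1 / 32 := by
        rw [Real.exp_neg, one_div]
        gcongr
        linarith [Real.add_one_le_exp (62 : ℝ)]
  linarith

/-! ### Sparse directions. -/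

/-- The unit vector with entries `± 1 / √k` at one selected coordinate of each block. -/
noncomputable def signedDirection {d k B : ℕ} (e : Fin k × Fin B ↪ Fin d)
    (v : (Fin k → Fin B) × (Fin k → Bool)) : EuclideanSpace ℝ (Fin d) :=
  ∑ i, (boolSign (v.2 i) / Real.sqrt k) • EuclideanSpace.single (e (i, v.1 i)) (1 : ℝ)

/-- Since `e` is injective, entries from different blocks never share a coordinate; only blocks
where the two selections agree contribute. -/
lemma inner_signedDirection {d k B : ℕ} (e : Fin k × Fin B ↪ Fin d)
    (v w : (Fin k → Fin B) × (Fin k → Bool)) :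
    inner ℝ (signedDirection e v) (signedDirection e w) = signedOverlap v w / k := by
  have h1 : ∀ i i' : Fin k, inner ℝ ((boolSign (v.2 i) / Real.sqrt k) •
      EuclideanSpace.single (e (i, v.1 i)) (1 : ℝ)) ((boolSign (w.2 i') / Real.sqrt k) •
      EuclideanSpace.single (e (i', w.1 i')) (1 : ℝ)) =
      if i = i' then (if v.1 i = w.1 i then boolSign (v.2 i) * boolSign (w.2 i) else 0) / k
      else 0 := by
    intro i i'
    rw [real_inner_smul_left, real_inner_smul_right, EuclideanSpace.inner_single_left]
    simp only [PiLp.single_apply, EmbeddingLike.apply_eq_iff_eq, Prod.mk.injEq]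
    by_cases h : i = i'
    · subst h
      have hk : Real.sqrt k * Real.sqrt k = k := Real.mul_self_sqrt (Nat.cast_nonneg k)
      by_cases h' : v.1 i = w.1 i
      · simp only [h', and_self, if_true, map_one, mul_one]
        rw [div_mul_div_comm, hk]
      · simp [h']
    · simp [h]
  rw [signedDirection, signedDirection, sum_inner]
  simp_rw [inner_sum, h1]
  simp [signedOverlap, Finset.sum_div]

lemma norm_signedDirection {d k B : ℕ} (hk : 0 < k) (e : Fin k × Fin B ↪ Fin d)
    (v : (Fin k → Fin B) × (Fin k → Bool)) : ‖signedDirection e v‖ = 1 := by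
  have h : ‖signedDirection e v‖ ^ 2 = 1 := by
    rw [← real_inner_self_eq_norm_sq, inner_signedDirection]
    have hk' : (k : ℝ) ≠ 0 := by positivity
    simp [signedOverlap, boolSign_mul_self, hk']
  exact (pow_eq_one_iff_of_nonneg (norm_nonneg _) two_ne_zero).1 h

lemma isSparse_smul_signedDirection {d k B : ℕ} (e : Fin k × Fin B ↪ Fin d)
    (v : (Fin k → Fin B) × (Fin k → Bool)) (a : ℝ) {s : ℝ} (hs : (k : ℝ) ≤ s) :
    IsSparse s (a • signedDirection e v) := by
  refine le_trans ?_ hs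
  have hsub : {j : Fin d | (a • signedDirection e v) j ≠ 0} ⊆ Set.range fun i => e (i, v.1 i) := by
    intro j hj
    by_contra hne
    refine hj ?_
    have h0 : ∀ i, j ≠ e (i, v.1 i) := fun i h => hne ⟨i, h.symm⟩
    have : signedDirection e v j = 0 := by
      rw [signedDirection, WithLp.ofLp_sum, Finset.sum_apply]
      refine Finset.sum_eq_zero fun i _ => ?_
      simp [h0 i]
    simp [this]
  have h1 := Set.ncard_le_ncard hsub (Set.finite_range _)
  have h2 : (Set.range fun i => e (i, v.1 i)).ncard ≤ k := by
    rw [← Set.image_univ]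
    refine (Set.ncard_image_le Set.finite_univ).trans ?_
    simp
  exact_mod_cast h1.trans h2

/-! ### Likelihood ratio of the regression model and its expansion. -/

lemma lintegral_const_add_gaussianReal {h : ℝ → ENNReal} (hh : Measurable h) (a : ℝ) :
    ∫⁻ z, h (a + z) ∂(gaussianReal 0 1) =
      ∫⁻ y, ENNReal.ofReal (Real.exp (a * y - a ^ 2 / 2)) * h y ∂(gaussianReal 0 1) := by
  have h1 : ∫⁻ z, h (a + z) ∂(gaussianReal 0 1) = ∫⁻ y, h y ∂(gaussianReal a 1) := by
    have := gaussianReal_map_const_add (μ := 0) (v := 1) a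
    rw [zero_add] at this
    rw [← this, lintegral_map hh (by fun_prop)]
  rw [h1, gaussianReal_of_var_ne_zero a one_ne_zero, gaussianReal_of_var_ne_zero 0 one_ne_zero,
    lintegral_withDensity_eq_lintegral_mul _ (measurable_gaussianPDF _ _) hh,
    lintegral_withDensity_eq_lintegral_mul _ (measurable_gaussianPDF _ _) (by fun_prop)]
  refine lintegral_congr fun y => ?_
  simp only [Pi.mul_apply]
  rw [← mul_assoc]
  congr 1
  rw [gaussianPDF, gaussianPDF, ← ENNReal.ofReal_mul (gaussianPDFReal_nonneg _ _ _)]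
  congr 1
  have h2 : Real.exp (-(y - a) ^ 2 / (2 * (1 : NNReal))) =
      Real.exp (a * y - a ^ 2 / 2) * Real.exp (-(y - 0) ^ 2 / (2 * (1 : NNReal))) := by
    rw [← Real.exp_add]
    congr 1
    simp
    ring
  rw [gaussianPDFReal, gaussianPDFReal, h2]
  ring

/-- The law of the data without signal. -/
lemma regressionLaw_zero (d : ℕ) : regressionLaw (0 : EuclideanSpace ℝ (Fin d)) =
    (stdGaussian (EuclideanSpace ℝ (Fin d))).prod (gaussianReal 0 1) := by
  simp [regressionLaw]

/-- The likelihood ratio of the linear regression model. -/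
lemma regressionLaw_eq_withDensity {d : ℕ} (θ : EuclideanSpace ℝ (Fin d)) :
    regressionLaw θ = ((stdGaussian (EuclideanSpace ℝ (Fin d))).prod
      (gaussianReal 0 1)).withDensity (fun p => ENNReal.ofReal
        (Real.exp (inner ℝ p.1 θ * p.2 - (inner ℝ p.1 θ) ^ 2 / 2))) := by
  refine Measure.ext_of_lintegral _ fun f hf => ?_
  rw [regressionLaw, lintegral_map hf (by fun_prop),
    lintegral_withDensity_eq_lintegral_mul _ (by fun_prop) hf,
    lintegral_prod _ (by fun_prop), lintegral_prod _ (by fun_prop)]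
  refine lintegral_congr fun x => ?_
  exact lintegral_const_add_gaussianReal (h := fun y => f (x, y)) (by fun_prop) (inner ℝ x θ)

instance isProbabilityMeasure_regressionLaw {d : ℕ} (θ : EuclideanSpace ℝ (Fin d)) :
    IsProbabilityMeasure (regressionLaw θ) :=
  Measure.isProbabilityMeasure_map (by fun_prop)

/-- With `w = u² + y²`, the exponent is at most `a w ≤ w / 8` in absolute value. The Taylor
remainder costs one factor `exp (w / 8)` and absorbing `w²` costs another, giving `exp (w / 4)`,
which is still Gaussian-integrable and factorizes in `u` and `y`. -/
lemma abs_exp_sub_one_sub_le {a u y : ℝ} (ha : 0 ≤ a) (ha8 : a ≤ 1 / 8) :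
    |Real.exp (a * u * y - (a * u) ^ 2 / 2) - 1 - a * u * y| ≤
      130 * a ^ 2 * (Real.exp (u ^ 2 / 4) * Real.exp (y ^ 2 / 4)) := by
  set w : ℝ := u ^ 2 + y ^ 2 with hw
  have hw0 : 0 ≤ w := by positivity
  set x : ℝ := a * u * y - (a * u) ^ 2 / 2 with hx
  have hxw : |x| ≤ a * w := by
    have huy : |u * y| ≤ w / 2 := by
      rw [abs_mul, hw, ← sq_abs u, ← sq_abs y]
      nlinarith [sq_nonneg (|u| - |y|)]
    have hau : a ^ 2 * u ^ 2 ≤ a * w := by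
      nlinarith [mul_nonneg ha (sq_nonneg u), mul_nonneg ha (sq_nonneg y)]
    rw [abs_le] at huy ⊢
    constructor <;> rw [hx] <;> nlinarith [mul_le_mul_of_nonneg_left huy.1 ha,
      mul_le_mul_of_nonneg_left huy.2 ha, sq_nonneg (a * u)]
  have h1 := abs_exp_sub_one_sub_id_le_mul_exp x
  have h2 : Real.exp |x| ≤ Real.exp (w / 8) := by
    gcongr; nlinarith
  have h3 : w ^ 2 ≤ 128 * Real.exp (w / 8) := by
    have := Real.quadratic_le_exp_of_nonneg (by positivity : 0 ≤ w / 8)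
    nlinarith
  have h4 : x ^ 2 ≤ a ^ 2 * w ^ 2 := by
    rw [← mul_pow, ← sq_abs x]; gcongr
  have h5 : Real.exp (w / 8) * Real.exp (w / 8) = Real.exp (w / 4) := by
    rw [← Real.exp_add]; ring_nf
  have h6 : x ^ 2 * Real.exp |x| ≤ 128 * a ^ 2 * Real.exp (w / 4) := by
    calc x ^ 2 * Real.exp |x| ≤ (a ^ 2 * (128 * Real.exp (w / 8))) * Real.exp (w / 8) := by
          gcongr
          exact h4.trans (by gcongr)
      _ = 128 * a ^ 2 * Real.exp (w / 4) := by rw [← h5]; ring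
  have h7 : (a * u) ^ 2 / 2 ≤ 2 * a ^ 2 * Real.exp (w / 4) := by
    have := Real.add_one_le_exp (w / 4)
    have hu : u ^ 2 / 2 ≤ 2 * Real.exp (w / 4) := by nlinarith [sq_nonneg y]
    nlinarith [mul_le_mul_of_nonneg_left hu (sq_nonneg a)]
  have h8 : Real.exp (u ^ 2 / 4) * Real.exp (y ^ 2 / 4) = Real.exp (w / 4) := by
    rw [← Real.exp_add]; congr 1; rw [hw]; ring
  rw [h8]
  calc |Real.exp x - 1 - a * u * y| = |(Real.exp x - 1 - x) + -((a * u) ^ 2 / 2)| := by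
        congr 1; rw [hx]; ring
    _ ≤ |Real.exp x - 1 - x| + |-((a * u) ^ 2 / 2)| := abs_add_le _ _
    _ ≤ 128 * a ^ 2 * Real.exp (w / 4) + 2 * a ^ 2 * Real.exp (w / 4) := by
        rw [abs_neg, abs_of_nonneg (by positivity : 0 ≤ (a * u) ^ 2 / 2)]
        exact add_le_add (h1.trans h6) h7
    _ = _ := by ring

lemma integrable_exp_sq_div_four_gaussianReal :
    Integrable (fun x : ℝ => Real.exp (x ^ 2 / 4)) (gaussianReal 0 1) := by
  rw [gaussianReal_of_var_ne_zero 0 one_ne_zero, integrable_withDensity_iff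
    (measurable_gaussianPDF _ _) (ae_of_all _ fun _ => gaussianPDF_lt_top)]
  have h := (integrable_exp_neg_mul_sq (by norm_num : (0 : ℝ) < 1 / 4)).const_mul
    (Real.sqrt (2 * Real.pi))⁻¹
  refine h.congr (ae_of_all _ fun x => ?_)
  simp only [toReal_gaussianPDF, gaussianPDFReal]
  rw [mul_left_comm, ← Real.exp_add]
  simp only [NNReal.coe_one, mul_one, sub_zero]
  congr 2
  ring

lemma integral_abs_gaussianReal_le : ∫ x : ℝ, |x| ∂(gaussianReal 0 1) ≤ 1 := by
  have hi : Integrable (fun x : ℝ => (1 + x ^ 2) / 2) (gaussianReal 0 1) :=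
    ((integrable_const 1).add (integrable_pow_gaussianReal 2)).div_const 2
  calc ∫ x : ℝ, |x| ∂(gaussianReal 0 1) ≤ ∫ x : ℝ, (1 + x ^ 2) / 2 ∂(gaussianReal 0 1) := by
        refine integral_mono_of_nonneg (ae_of_all _ fun x => abs_nonneg x) hi
          (ae_of_all _ fun x => ?_)
        change |x| ≤ (1 + x ^ 2) / 2
        rw [← sq_abs]
        nlinarith [sq_nonneg (|x| - 1)]
    _ = 1 := by
        rw [integral_div, integral_add (integrable_const 1) (integrable_pow_gaussianReal 2),
          integral_sq_gaussianReal]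
        simp

/-! ### The hidden law: distance to the regression law and correlations. -/

/-- Truncation at level `L`. -/
noncomputable def truncAt (L y : ℝ) : ℝ := if |y| ≤ L then y else 0

lemma measurable_truncAt (L : ℝ) : Measurable (truncAt L) :=
  Measurable.ite (measurableSet_le (by fun_prop) (by fun_prop)) measurable_id measurable_const

lemma abs_truncAt_le {L : ℝ} (hL : 0 ≤ L) (y : ℝ) : |truncAt L y| ≤ L := by
  unfold truncAt; split_ifs with h
  · exact h
  · simpa using hL

lemma abs_sub_truncAt_le {L : ℝ} (hL : 0 < L) (y : ℝ) : |y - truncAt L y| ≤ y ^ 2 / L := by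
  unfold truncAt; split_ifs with h
  · simp; positivity
  · rw [sub_zero, le_div_iff₀ hL, ← sq_abs]
    nlinarith [abs_nonneg y]

lemma truncAt_sq_le (L y : ℝ) : truncAt L y ^ 2 ≤ y ^ 2 := by
  unfold truncAt; split_ifs with h
  · exact le_rfl
  · simp; positivity

/-- The density of the hidden corrupted law, as a function of the signal statistic and response. -/
noncomputable def hiddenDensity (g : ℝ → ℝ) (R a u y : ℝ) : ℝ := 1 + a * truncAt (1 / (a * R)) y * g u

/-- The truncation level `1 / (a R)` is chosen so that the perturbation never exceeds `1`, which
keeps the density nonnegative. It grows as `a` shrinks, so truncating costs only `O(a²)`. -/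
lemma abs_hiddenDensity_sub_one_le {g : ℝ → ℝ} {R a : ℝ} (hR : 0 < R) (hb : ∀ x, |g x| ≤ R)
    (ha : 0 < a) (u y : ℝ) : |hiddenDensity g R a u y - 1| ≤ 1 := by
  rw [hiddenDensity, add_sub_cancel_left, abs_mul, abs_mul, abs_of_pos ha]
  calc a * |truncAt (1 / (a * R)) y| * |g u| ≤ a * (1 / (a * R)) * R := by
        gcongr
        · exact abs_truncAt_le (by positivity) y
        · exact hb u
    _ = 1 := by field_simp

lemma hiddenDensity_nonneg {g : ℝ → ℝ} {R a : ℝ} (hR : 0 < R) (hb : ∀ x, |g x| ≤ R)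
    (ha : 0 < a) (u y : ℝ) : 0 ≤ hiddenDensity g R a u y := by
  have := (abs_le.1 (abs_hiddenDensity_sub_one_le hR hb ha u y)).1
  linarith

lemma abs_hiddenDensity_le {g : ℝ → ℝ} {R a : ℝ} (hR : 0 < R) (hb : ∀ x, |g x| ≤ R)
    (ha : 0 < a) (u y : ℝ) : |hiddenDensity g R a u y| ≤ 2 := by
  have h := (abs_le.1 (abs_hiddenDensity_sub_one_le hR hb ha u y)).2
  rw [abs_of_nonneg (hiddenDensity_nonneg hR hb ha u y)]
  linarith

/-- The total variation distance between the regression law and the hidden law. -/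
lemma lintegral_density_sub_le {g : ℝ → ℝ} {R a τ : ℝ} (hR : 0 < R)
    (hg : Measurable g) (hb : ∀ x, |g x| ≤ R) (ha : 0 < a) (ha8 : a ≤ 1 / 8)
    (hτ : ∫ x, |x - g x| ∂(gaussianReal 0 1) ≤ τ) :
    ∫⁻ p : ℝ × ℝ, (ENNReal.ofReal (Real.exp (a * p.1 * p.2 - (a * p.1) ^ 2 / 2)) -
        ENNReal.ofReal (hiddenDensity g R a p.1 p.2))
        ∂((gaussianReal 0 1).prod (gaussianReal 0 1)) ≤
      ENNReal.ofReal (a * (130 * (∫ x : ℝ, Real.exp (x ^ 2 / 4) ∂(gaussianReal 0 1)) ^ 2 * a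
        + τ + R ^ 2 * a)) := by
  set E : ℝ := ∫ x : ℝ, Real.exp (x ^ 2 / 4) ∂(gaussianReal 0 1) with hE
  let F : ℝ × ℝ → ℝ := fun p => 130 * a ^ 2 * (Real.exp (p.1 ^ 2 / 4) * Real.exp (p.2 ^ 2 / 4)) +
    (a * (|p.1 - g p.1| * |p.2|) + a ^ 2 * R ^ 2 * (1 * p.2 ^ 2))
  have hF : ∀ p : ℝ × ℝ, Real.exp (a * p.1 * p.2 - (a * p.1) ^ 2 / 2) -
      hiddenDensity g R a p.1 p.2 ≤ F p := by
    rintro ⟨u, y⟩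
    simp only [F]
    have h1 := (abs_le.1 (abs_exp_sub_one_sub_le (u := u) (y := y) ha.le ha8)).2
    -- The linear terms differ through replacing `u` by `g u`, at cost `a τ`, and through truncating
    -- `y`, at cost `a² R²`.
    have h2 : a * u * y - a * truncAt (1 / (a * R)) y * g u =
        a * ((u - g u) * y) + a * (g u * (y - truncAt (1 / (a * R)) y)) := by ring
    have h3 : (u - g u) * y ≤ |u - g u| * |y| := by
      rw [← abs_mul]; exact le_abs_self _
    have h4 : g u * (y - truncAt (1 / (a * R)) y) ≤ R * (y ^ 2 / (1 / (a * R))) := by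
      refine (le_abs_self _).trans ?_
      rw [abs_mul]
      gcongr
      · exact hb u
      · exact abs_sub_truncAt_le (by positivity) y
    have h5 : R * (y ^ 2 / (1 / (a * R))) = a * R ^ 2 * y ^ 2 := by field_simp
    rw [h5] at h4
    rw [hiddenDensity]
    have h6 := mul_le_mul_of_nonneg_left h3 ha.le
    have h7 := mul_le_mul_of_nonneg_left h4 ha.le
    nlinarith
  have hi1 : Integrable (fun p : ℝ × ℝ => Real.exp (p.1 ^ 2 / 4) * Real.exp (p.2 ^ 2 / 4))
      ((gaussianReal 0 1).prod (gaussianReal 0 1)) :=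
    integrable_exp_sq_div_four_gaussianReal.mul_prod integrable_exp_sq_div_four_gaussianReal
  have hid : Integrable (fun x : ℝ => x) (gaussianReal 0 1) := by
    simpa using integrable_pow_gaussianReal 1
  have hi2 : Integrable (fun p : ℝ × ℝ => |p.1 - g p.1| * |p.2|)
      ((gaussianReal 0 1).prod (gaussianReal 0 1)) :=
    (hid.sub (integrable_of_measurable_of_bounded hg hb)).abs.mul_prod hid.abs
  have hi3 : Integrable (fun p : ℝ × ℝ => (1 : ℝ) * p.2 ^ 2)
      ((gaussianReal 0 1).prod (gaussianReal 0 1)) :=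
    (integrable_const (1 : ℝ)).mul_prod (integrable_pow_gaussianReal 2)
  have hFi : Integrable F ((gaussianReal 0 1).prod (gaussianReal 0 1)) :=
    (hi1.const_mul _).add ((hi2.const_mul _).add (hi3.const_mul _))
  have hF0 : ∀ p, 0 ≤ F p := fun p => by positivity
  calc _ ≤ ∫⁻ p, ENNReal.ofReal (F p) ∂((gaussianReal 0 1).prod (gaussianReal 0 1)) := by
        refine lintegral_mono fun p => ?_
        rw [← ENNReal.ofReal_sub _ (hiddenDensity_nonneg hR hb ha _ _)]
        exact ENNReal.ofReal_le_ofReal (hF p)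
    _ = ENNReal.ofReal (∫ p, F p ∂((gaussianReal 0 1).prod (gaussianReal 0 1))) :=
        (ofReal_integral_eq_lintegral_ofReal hFi (ae_of_all _ hF0)).symm
    _ ≤ _ := by
        refine ENNReal.ofReal_le_ofReal ?_
        have hi4 : Integrable (fun p : ℝ × ℝ => a * (|p.1 - g p.1| * |p.2|) +
            a ^ 2 * R ^ 2 * (1 * p.2 ^ 2)) ((gaussianReal 0 1).prod (gaussianReal 0 1)) :=
          (hi2.const_mul a).add (hi3.const_mul (a ^ 2 * R ^ 2))
        have hFe : ∫ p, F p ∂((gaussianReal 0 1).prod (gaussianReal 0 1)) =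
            130 * a ^ 2 * (E * E) + (a * ((∫ x, |x - g x| ∂(gaussianReal 0 1)) *
              ∫ x : ℝ, |x| ∂(gaussianReal 0 1)) + a ^ 2 * R ^ 2) := by
          simp only [F]
          rw [integral_add (hi1.const_mul _) hi4, integral_add (hi2.const_mul a)
            (hi3.const_mul (a ^ 2 * R ^ 2)), integral_const_mul, integral_const_mul,
            integral_const_mul,
            integral_prod_mul (fun x : ℝ => Real.exp (x ^ 2 / 4)) (fun x : ℝ => Real.exp (x ^ 2 / 4)),
            integral_prod_mul (fun x : ℝ => |x - g x|) (fun x : ℝ => |x|),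
            integral_prod_mul (fun _ : ℝ => (1 : ℝ)) (fun x : ℝ => x ^ 2), integral_sq_gaussianReal]
          simp [hE]
        rw [hFe]
        have h8 : (∫ x, |x - g x| ∂(gaussianReal 0 1)) * ∫ x : ℝ, |x| ∂(gaussianReal 0 1) ≤ τ := by
          have h0 : 0 ≤ ∫ x, |x - g x| ∂(gaussianReal 0 1) := integral_nonneg fun x => abs_nonneg _
          exact (mul_le_of_le_one_right h0 integral_abs_gaussianReal_le).trans hτ
        nlinarith [mul_le_mul_of_nonneg_left h8 ha.le]

section HiddenLaw

variable {d : ℕ} {g : ℝ → ℝ} {R a : ℝ}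

lemma measurable_hiddenDensity (hg : Measurable g) (v : EuclideanSpace ℝ (Fin d)) :
    Measurable fun p : Observation d => hiddenDensity g R a (inner ℝ p.1 v) p.2 := by
  have := measurable_truncAt (1 / (a * R))
  unfold hiddenDensity
  fun_prop

lemma integral_comp_inner_eq {f : ℝ → ℝ} (hf : Measurable f) {v : EuclideanSpace ℝ (Fin d)}
    (hv : ‖v‖ = 1) :
    ∫ x, f (inner ℝ x v) ∂(stdGaussian (EuclideanSpace ℝ (Fin d))) =
      ∫ u, f u ∂(gaussianReal 0 1) := by
  rw [← stdGaussian_map_inner hv, integral_map (by fun_prop) hf.aestronglyMeasurable]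

lemma integrable_truncAt (L : ℝ) (hL : 0 ≤ L) : Integrable (truncAt L) (gaussianReal 0 1) :=
  integrable_of_measurable_of_bounded (measurable_truncAt L) (abs_truncAt_le hL)

lemma integral_hiddenDensity (hR : 0 < R) (hg : Measurable g) (hb : ∀ x, |g x| ≤ R) (ha : 0 < a)
    (h0 : ∫ x, g x ∂(gaussianReal 0 1) = 0) {v : EuclideanSpace ℝ (Fin d)} (hv : ‖v‖ = 1) :
    ∫ p : Observation d, hiddenDensity g R a (inner ℝ p.1 v) p.2
      ∂((stdGaussian (EuclideanSpace ℝ (Fin d))).prod (gaussianReal 0 1)) = 1 := by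
  have hgi : Integrable (fun x => g (inner ℝ x v)) (stdGaussian (EuclideanSpace ℝ (Fin d))) :=
    integrable_of_measurable_of_bounded (by fun_prop) fun x => hb _
  have hi := (hgi.mul_prod (integrable_truncAt (1 / (a * R)) (by positivity))).const_mul a
  have h1 : (fun p : Observation d => hiddenDensity g R a (inner ℝ p.1 v) p.2) =
      fun p => 1 + a * (g (inner ℝ p.1 v) * truncAt (1 / (a * R)) p.2) := by
    ext p; rw [hiddenDensity]; ring
  rw [h1, integral_add (integrable_const 1) hi, integral_const_mul,
    integral_prod_mul (fun x => g (inner ℝ x v)) (truncAt (1 / (a * R))),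
    integral_comp_inner_eq hg hv, h0]
  simp

/-- The pairwise correlation of the hidden laws. -/
lemma integral_hiddenDensity_mul_le (hR : 0 < R) (hg : Measurable g) (hb : ∀ x, |g x| ≤ R)
    (hsupp : ∀ x, R < |x| → g x = 0) (ha : 0 < a)
    (h0 : ∫ x, g x ∂(gaussianReal 0 1) = 0) (h1 : ∫ x, x * g x ∂(gaussianReal 0 1) = 0)
    {v w : EuclideanSpace ℝ (Fin d)} (hv : ‖v‖ = 1) (hw : ‖w‖ = 1) :
    ∫ p : Observation d, hiddenDensity g R a (inner ℝ p.1 v) p.2 *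
      hiddenDensity g R a (inner ℝ p.1 w) p.2
      ∂((stdGaussian (EuclideanSpace ℝ (Fin d))).prod (gaussianReal 0 1)) ≤
    Real.exp (a ^ 2 * (R ^ 2 * (4 + (2 * Real.exp (R ^ 2) + 4 * R ^ 4 * Real.exp (R ^ 2) +
      2 * R ^ 2)) * (inner ℝ v w) ^ 2)) := by
  set D : ℝ := R ^ 2 * (4 + (2 * Real.exp (R ^ 2) + 4 * R ^ 4 * Real.exp (R ^ 2) +
      2 * R ^ 2)) with hD
  set χ : ℝ → ℝ := truncAt (1 / (a * R)) with hχ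
  have hχm : Measurable χ := measurable_truncAt _
  have hχi : Integrable χ (gaussianReal 0 1) := integrable_truncAt _ (by positivity)
  have hχ2i : Integrable (fun y => χ y ^ 2) (gaussianReal 0 1) :=
    Integrable.mono' (integrable_pow_gaussianReal 2) (by fun_prop) (ae_of_all _ fun y => by
      rw [Real.norm_eq_abs, abs_of_nonneg (sq_nonneg _)]; exact truncAt_sq_le _ _)
  have hχ2 : ∫ y, χ y ^ 2 ∂(gaussianReal 0 1) ≤ 1 := by
    rw [← integral_sq_gaussianReal]
    exact integral_mono hχ2i (integrable_pow_gaussianReal 2) fun y => truncAt_sq_le _ _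
  have hχ20 : 0 ≤ ∫ y, χ y ^ 2 ∂(gaussianReal 0 1) := integral_nonneg fun y => sq_nonneg _
  have hgi : ∀ z : EuclideanSpace ℝ (Fin d), Integrable (fun x => g (inner ℝ x z))
      (stdGaussian (EuclideanSpace ℝ (Fin d))) := fun z =>
    integrable_of_measurable_of_bounded (by fun_prop) fun x => hb _
  have hggi : Integrable (fun x => g (inner ℝ x v) * g (inner ℝ x w))
      (stdGaussian (EuclideanSpace ℝ (Fin d))) :=
    integrable_of_measurable_of_bounded (R := R * R) (by fun_prop) fun x => by
      rw [abs_mul]; exact mul_le_mul (hb _) (hb _) (abs_nonneg _) hR.le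
  have hgg : |∫ x, g (inner ℝ x v) * g (inner ℝ x w)
      ∂(stdGaussian (EuclideanSpace ℝ (Fin d)))| ≤ D * (inner ℝ v w) ^ 2 := by
    have hmap := integral_map (μ := stdGaussian (EuclideanSpace ℝ (Fin d)))
      (φ := fun x => ((inner ℝ x v : ℝ), (inner ℝ x w : ℝ))) (f := fun p => g p.1 * g p.2)
      (by fun_prop) (by fun_prop)
    rw [stdGaussian_map_inner_pair hv hw, integral_map (by fun_prop) (by fun_prop)] at hmap
    rw [← hmap]
    exact abs_integral_correlated_le hg hb hsupp h0 h1 _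
  have i1 := ((hgi v).mul_prod hχi).const_mul a
  have i2 := ((hgi w).mul_prod hχi).const_mul a
  have i3 := (hggi.mul_prod hχ2i).const_mul (a ^ 2)
  -- The two terms linear in `a` integrate to zero since `g` has mean zero. Only the `a²` term
  -- remains, and it factorizes over covariate and response.
  have hexp : (fun p : Observation d => hiddenDensity g R a (inner ℝ p.1 v) p.2 *
      hiddenDensity g R a (inner ℝ p.1 w) p.2) = fun p =>
      ((1 + a * (g (inner ℝ p.1 v) * χ p.2)) + a * (g (inner ℝ p.1 w) * χ p.2)) +
        a ^ 2 * ((g (inner ℝ p.1 v) * g (inner ℝ p.1 w)) * χ p.2 ^ 2) := by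
    ext p; rw [hiddenDensity, hiddenDensity, ← hχ]; ring
  have j1 : Integrable (fun p : Observation d => 1 + a * (g (inner ℝ p.1 v) * χ p.2))
      ((stdGaussian (EuclideanSpace ℝ (Fin d))).prod (gaussianReal 0 1)) :=
    (integrable_const 1).add i1
  have j2 : Integrable (fun p : Observation d => (1 + a * (g (inner ℝ p.1 v) * χ p.2)) +
      a * (g (inner ℝ p.1 w) * χ p.2))
      ((stdGaussian (EuclideanSpace ℝ (Fin d))).prod (gaussianReal 0 1)) := j1.add i2
  rw [hexp, integral_add j2 i3, integral_add j1 i2, integral_add (integrable_const 1) i1,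
    integral_const_mul, integral_const_mul, integral_const_mul,
    integral_prod_mul (fun x => g (inner ℝ x v)) χ, integral_prod_mul (fun x => g (inner ℝ x w)) χ,
    integral_prod_mul (fun x => g (inner ℝ x v) * g (inner ℝ x w)) (fun y => χ y ^ 2),
    integral_comp_inner_eq hg hv, integral_comp_inner_eq hg hw, h0]
  simp only [integral_const, probReal_univ, smul_eq_mul, mul_one, zero_mul, mul_zero, add_zero]
  have hD0 : 0 ≤ D * (inner ℝ v w) ^ 2 := by positivity
  have h2 : (∫ x, g (inner ℝ x v) * g (inner ℝ x w) ∂(stdGaussian (EuclideanSpace ℝ (Fin d)))) *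
      ∫ y, χ y ^ 2 ∂(gaussianReal 0 1) ≤ D * (inner ℝ v w) ^ 2 :=
    calc _ ≤ D * (inner ℝ v w) ^ 2 * ∫ y, χ y ^ 2 ∂(gaussianReal 0 1) := by
          gcongr; exact (le_abs_self _).trans hgg
      _ ≤ D * (inner ℝ v w) ^ 2 := mul_le_of_le_one_right hD0 hχ2
  have h3 := Real.add_one_le_exp (a ^ 2 * (D * (inner ℝ v w) ^ 2))
  have h4 := mul_le_mul_of_nonneg_left h2 (sq_nonneg a)
  linarith

/-- An `ε`-corruption of the regression law simulates the hidden law up to a small error. -/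
lemma exists_isCorruptedLaw_hiddenDensity {τ ε t : ℝ} (hR : 0 < R)
    (hg : Measurable g) (hb : ∀ x, |g x| ≤ R) (ha : 0 < a) (ha8 : a ≤ 1 / 8)
    (h0 : ∫ x, g x ∂(gaussianReal 0 1) = 0)
    (hτ : ∫ x, |x - g x| ∂(gaussianReal 0 1) ≤ τ) (hε : 0 < ε)
    (ht : a * (130 * (∫ x : ℝ, Real.exp (x ^ 2 / 4) ∂(gaussianReal 0 1)) ^ 2 * a
        + τ + R ^ 2 * a) ≤ t) {v : EuclideanSpace ℝ (Fin d)} (hv : ‖v‖ = 1) (n : ℕ) :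
    ∃ Q : Measure (Fin n → Observation d), IsCorruptedLaw ε n (regressionLaw (a • v)) Q ∧
      ∀ f : (Fin n → Observation d) → ENNReal, Measurable f → (∀ x, f x ≤ 1) →
        ∫⁻ x, f x ∂Q ≤ ∫⁻ x, f x * ENNReal.ofReal
          (∏ i, hiddenDensity g R a (inner ℝ (x i).1 v) (x i).2)
          ∂(Measure.pi fun _ => regressionLaw (0 : EuclideanSpace ℝ (Fin d))) +
          ENNReal.ofReal (t / ε) := by
  set μ : Measure (Observation d) :=
    (stdGaussian (EuclideanSpace ℝ (Fin d))).prod (gaussianReal 0 1) with hμ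
  let p : Observation d → ENNReal := fun x => ENNReal.ofReal
    (Real.exp (inner ℝ x.1 (a • v) * x.2 - (inner ℝ x.1 (a • v)) ^ 2 / 2))
  let qr : Observation d → ℝ := fun x => hiddenDensity g R a (inner ℝ x.1 v) x.2
  let q : Observation d → ENNReal := fun x => ENNReal.ofReal (qr x)
  have hpm : Measurable p := by fun_prop
  have hqrm : Measurable qr := measurable_hiddenDensity hg v
  have hqm : Measurable q := hqrm.ennreal_ofReal
  have hqr0 : ∀ x, 0 ≤ qr x := fun x => hiddenDensity_nonneg hR hb ha _ _
  have hlaw : regressionLaw (a • v) = μ.withDensity p := regressionLaw_eq_withDensity _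
  have hp1 : ∫⁻ x, p x ∂μ = 1 := by
    have : (μ.withDensity p) Set.univ = 1 := by rw [← hlaw]; exact measure_univ
    simpa using this
  have hq1 : ∫⁻ x, q x ∂μ = 1 := by
    have hi : Integrable qr μ :=
      integrable_of_measurable_of_bounded hqrm fun x => abs_hiddenDensity_le hR hb ha _ _
    rw [← ofReal_integral_eq_lintegral_ofReal hi (ae_of_all _ hqr0),
      integral_hiddenDensity hR hg hb ha h0 hv, ENNReal.ofReal_one]
  have hqp : IsProbabilityMeasure (μ.withDensity q) := ⟨by simpa using hq1⟩
  obtain ⟨π, hπ1, hπ2, hπ3⟩ := exists_coupling_of_densities μ hpm hqm hp1 hq1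
  have hπ4 : π {z | z.1 ≠ z.2} ≤ ENNReal.ofReal t := by
    refine hπ3.trans (le_trans ?_ (ENNReal.ofReal_le_ofReal ht))
    -- Both densities depend on the covariate only through `⟨x, v⟩`, so the distance is a
    -- two-dimensional Gaussian integral.
    have hmap : μ.map (Prod.map (fun x => (inner ℝ x v : ℝ)) id) =
        (gaussianReal 0 1).prod (gaussianReal 0 1) := by
      rw [hμ, ← Measure.map_prod_map _ _ (by fun_prop) measurable_id, stdGaussian_map_inner hv,
        Measure.map_id]
    have hkey := lintegral_density_sub_le hR hg hb ha ha8 hτ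
    have hχ := measurable_truncAt (1 / (a * R))
    rw [← hmap, lintegral_map (by unfold hiddenDensity; fun_prop) (by fun_prop)] at hkey
    refine le_trans (le_of_eq ?_) hkey
    refine lintegral_congr fun x => ?_
    simp only [p, q, qr, Prod.map_fst, Prod.map_snd, id, real_inner_smul_right]
  obtain ⟨Q, hQ1, hQ2⟩ := exists_isCorruptedLaw_of_coupling π (hπ1.trans hlaw.symm) hπ2 hε hπ4 n
  refine ⟨Q, hQ1, fun f hf hf1 => (hQ2 f hf hf1).trans (le_of_eq ?_)⟩
  congr 1
  rw [pi_withDensity_eq μ hqm, regressionLaw_zero, lintegral_withDensity_eq_lintegral_mul _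
    (by fun_prop) hf]
  refine lintegral_congr fun x => ?_
  rw [Pi.mul_apply, mul_comm, ENNReal.ofReal_prod_of_nonneg fun i _ => hqr0 (x i)]

end HiddenLaw

/-! ### Impossibility of testing. -/

/-- The adversary may leave the data unchanged. -/
lemma exists_isCorruptedLaw_self {S : Type*} [MeasurableSpace S] [MeasurableEq S] {ε : ℝ}
    (hε : 0 < ε) (n : ℕ) (P : Measure S) [IsProbabilityMeasure P] :
    ∃ Q : Measure (Fin n → S), IsCorruptedLaw ε n P Q ∧
      ∀ f : (Fin n → S) → ENNReal, Measurable f → (∀ x, f x ≤ 1) →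
        ∫⁻ x, f x ∂Q ≤ ∫⁻ x, f x ∂(Measure.pi fun _ => P) := by
  have h0 : (P.map fun x => (x, x)) {z | z.1 ≠ z.2} ≤ ENNReal.ofReal 0 := by
    have hm : MeasurableSet {z : S × S | z.1 ≠ z.2} := (measurableSet_diagonal (α := S)).compl
    rw [Measure.map_apply (by fun_prop) hm]
    have : (fun x : S => (x, x)) ⁻¹' {z : S × S | z.1 ≠ z.2} = ∅ := by ext x; simp
    simp [this]
  obtain ⟨Q, hQ1, hQ2⟩ := exists_isCorruptedLaw_of_coupling (P := P) (P' := P)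
    (P.map fun x => (x, x))
    (by rw [Measure.map_map measurable_fst (by fun_prop)]; exact Measure.map_id)
    (by rw [Measure.map_map measurable_snd (by fun_prop)]; exact Measure.map_id) hε h0 n
  refine ⟨Q, hQ1, fun f hf hf1 => ?_⟩
  simpa using hQ2 f hf hf1

/-- The probability that the test rejects, as an integral of its rejection function. -/
lemma bind_kernel_apply {Ω : Type*} [MeasurableSpace Ω] (Q : Measure Ω) (T : Kernel Ω Bool)
    (b : Bool) : (Q.bind T) {b} = ∫⁻ x, T x {b} ∂Q :=
  Measure.bind_apply (measurableSet_singleton b) T.measurable.aemeasurable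

lemma lintegral_kernel_bool_add {Ω : Type*} [MeasurableSpace Ω] (μ : Measure Ω)
    [IsProbabilityMeasure μ] (T : Kernel Ω Bool) [IsMarkovKernel T] :
    ∫⁻ x, T x {false} ∂μ + ∫⁻ x, T x {true} ∂μ = 1 := by
  rw [← lintegral_add_left (T.measurable_coe (measurableSet_singleton false))]
  have h : ∀ x, T x {false} + T x {true} = 1 := fun x => by
    rw [← measure_union (by simp) (measurableSet_singleton true)]
    have : ({false} ∪ {true} : Set Bool) = Set.univ := by ext b; cases b <;> simp
    rw [this, measure_univ]
  simp [h]

/-- The core lower bound: no test can distinguish in the small-sample regime. -/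
lemma not_robustlyDistinguishes {δ : ℝ} (hδ : 0 < δ) (hδ1 : δ < 1) {d n : ℕ} (hd : 2 ≤ d)
    {g : ℝ → ℝ} {R a τ ε : ℝ} (hR : 0 < R) (hg : Measurable g) (hb : ∀ x, |g x| ≤ R)
    (hsupp : ∀ x, R < |x| → g x = 0) (h0 : ∫ x, g x ∂(gaussianReal 0 1) = 0)
    (h1 : ∫ x, x * g x ∂(gaussianReal 0 1) = 0) (hτ : ∫ x, |x - g x| ∂(gaussianReal 0 1) ≤ τ)
    (ha : 0 < a) (ha8 : a ≤ 1 / 8) (hε : 0 < ε)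
    (ht : a * (130 * (∫ x : ℝ, Real.exp (x ^ 2 / 4) ∂(gaussianReal 0 1)) ^ 2 * a
        + τ + R ^ 2 * a) ≤ ε / 20)
    (hn : n * (R ^ 2 * (4 + (2 * Real.exp (R ^ 2) + 4 * R ^ 4 * Real.exp (R ^ 2) + 2 * R ^ 2))) ≤
      δ * (1 - δ) / 1024 * ((d : ℝ) ^ (1 - δ) * Real.log d))
    (T : Kernel (Fin n → Observation d) Bool) [IsMarkovKernel T] :
    ¬ RobustlyDistinguishes T ((d : ℝ) ^ (1 - δ)) ε a := by
  intro hT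
  set D : ℝ := R ^ 2 * (4 + (2 * Real.exp (R ^ 2) + 4 * R ^ 4 * Real.exp (R ^ 2) +
      2 * R ^ 2)) with hD
  have hD0 : 0 < D := by positivity
  set s : ℝ := (d : ℝ) ^ (1 - δ) with hs
  have hd1 : (1 : ℝ) < d := by exact_mod_cast hd
  have hs1 : 1 ≤ s := Real.one_le_rpow hd1.le (by linarith)
  have hsd : s ≤ d := by
    calc s ≤ (d : ℝ) ^ (1 : ℝ) := Real.rpow_le_rpow_of_exponent_le hd1.le (by linarith)
      _ = d := Real.rpow_one _
  set k : ℕ := ⌊s⌋₊ with hk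
  set B : ℕ := d / k with hB
  have hk1 : 1 ≤ k := (Nat.one_le_floor_iff s).2 hs1
  have hks : (k : ℝ) ≤ s := Nat.floor_le (by linarith)
  have hks2 : s ≤ 2 * k := by
    have := Nat.lt_floor_add_one s
    have hk1' : (1 : ℝ) ≤ k := by exact_mod_cast hk1
    linarith
  have hk0 : (0 : ℝ) < k := by exact_mod_cast hk1
  have hkd : k ≤ d := by exact_mod_cast hks.trans hsd
  have hB1 : 1 ≤ B := (Nat.one_le_div_iff (by omega)).2 hkd
  have hkB : k * B ≤ d := Nat.mul_div_le d k
  -- The first `k B` coordinates form `k` blocks of size `B`; any remaining ones are never used.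
  let e : Fin k × Fin B ↪ Fin d := finProdFinEquiv.toEmbedding.trans (Fin.castLEEmb hkB)
  let V : Type := (Fin k → Fin B) × (Fin k → Bool)
  have hV : Nonempty V := ⟨(fun _ => ⟨0, hB1⟩, fun _ => true)⟩
  have hunit : ∀ v : V, ‖signedDirection e v‖ = 1 := norm_signedDirection hk1 e
  set μ : Measure (Observation d) := regressionLaw (0 : EuclideanSpace ℝ (Fin d)) with hμ
  let q : V → Observation d → ℝ := fun v x =>
    hiddenDensity g R a (inner ℝ x.1 (signedDirection e v)) x.2
  have hqm : ∀ v, Measurable (q v) := fun v => measurable_hiddenDensity hg _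
  have hq0 : ∀ v x, 0 ≤ q v x := fun v x => hiddenDensity_nonneg hR hb ha _ _
  have hq1 : ∀ v, ∫ x, q v x ∂μ = 1 := fun v => by
    rw [hμ, regressionLaw_zero]
    exact integral_hiddenDensity hR hg hb ha h0 (hunit v)
  set t : ℝ := n * D / k ^ 2 with htdef
  have hqq : ∀ v w, (∫ x, q v x * q w x ∂μ) ^ n ≤ Real.exp (t * signedOverlap v w ^ 2) := by
    intro v w
    have h2 : ∫ x, q v x * q w x ∂μ ≤ Real.exp (a ^ 2 * (D * (signedOverlap v w / k) ^ 2)) := by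
      rw [hμ, regressionLaw_zero, ← inner_signedDirection e v w]
      exact integral_hiddenDensity_mul_le hR hg hb hsupp ha h0 h1 (hunit v) (hunit w)
    have h3 : 0 ≤ ∫ x, q v x * q w x ∂μ :=
      integral_nonneg fun x => mul_nonneg (hq0 v x) (hq0 w x)
    -- The factor `a²` is discarded: a sample bound free of `γ` is all that is needed.
    have ha1 : a ^ 2 ≤ 1 := by nlinarith
    calc _ ≤ (Real.exp (a ^ 2 * (D * (signedOverlap v w / k) ^ 2))) ^ n := by gcongr
      _ ≤ (Real.exp (1 * (D * (signedOverlap v w / k) ^ 2))) ^ n := by gcongr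
      _ = Real.exp (t * signedOverlap v w ^ 2) := by
        rw [← Real.exp_nat_mul, htdef]; congr 1; field_simp
  have htk : t * k ≤ δ * (1 - δ) / 512 * Real.log d := by
    have hlog : 0 ≤ Real.log d := Real.log_nonneg hd1.le
    have hδ' : 0 < 1 - δ := by linarith
    have : t * k = n * D / k := by rw [htdef]; field_simp
    rw [this, div_le_iff₀ hk0]
    calc n * D ≤ δ * (1 - δ) / 1024 * (s * Real.log d) := hn
      _ ≤ δ * (1 - δ) / 1024 * (2 * k * Real.log d) := by gcongr
      _ = _ := by ring
  have hsum : ∑ v, ∑ w, (∫ x, q v x * q w x ∂μ) ^ n ≤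
      (1 + (1 / 4 : ℝ) ^ 2) * (Fintype.card V : ℝ) ^ 2 := by
    rw [Finset.sum_comm]
    calc ∑ w, ∑ v, (∫ x, q v x * q w x ∂μ) ^ n
        ≤ ∑ _w : V, (Fintype.card V : ℝ) * (1 + (1 / 4) ^ 2) := by
          refine Finset.sum_le_sum fun w _ => ?_
          exact (Finset.sum_le_sum fun v _ => hqq v w).trans
            (sum_exp_sq_signedOverlap_le_of_sparse hδ hδ1 hd rfl rfl w htk)
      _ = _ := by
          rw [Finset.sum_const, Finset.card_univ, nsmul_eq_mul]; ring
  set κ : Measure (Fin n → Observation d) := Measure.pi fun _ => μ with hκ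
  let F : (Fin n → Observation d) → ENNReal := fun x => T x {true}
  have hFm : Measurable F := T.measurable_coe (measurableSet_singleton true)
  have hF1 : ∀ x, F x ≤ 1 := fun x => prob_le_one
  let f : (Fin n → Observation d) → ℝ := fun x => (F x).toReal
  have hfm : Measurable f := hFm.ennreal_toReal
  have hf0 : ∀ x, 0 ≤ f x := fun x => ENNReal.toReal_nonneg
  have hf1 : ∀ x, |f x| ≤ 1 := fun x => by
    rw [abs_of_nonneg (hf0 x)]
    exact ENNReal.toReal_le_of_le_ofReal zero_le_one (by simpa using hF1 x)
  have hFf : ∀ x, F x = ENNReal.ofReal (f x) := fun x =>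
    (ENNReal.ofReal_toReal ((hF1 x).trans_lt ENNReal.one_lt_top).ne).symm
  have hnull : ∫ x, f x ∂κ ≤ 1 / 3 := by
    obtain ⟨Q, hQ1, hQ2⟩ := exists_isCorruptedLaw_self hε n μ
    have h2 := (hT 0 (by simp [IsSparse]; linarith) Q hQ1).1 (by simp)
    rw [bind_kernel_apply] at h2
    have h3 := h2.trans_le (hQ2 (fun x => T x {false})
      (T.measurable_coe (measurableSet_singleton false)) fun x => prob_le_one)
    have h4 := lintegral_kernel_bool_add κ T
    rw [integral_toReal hFm.aemeasurable (ae_of_all _ fun x => (hF1 x).trans_lt ENNReal.one_lt_top)]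
    have h5 : ∫⁻ x, T x {false} ∂κ ≠ ⊤ := fun h => by rw [h] at h4; simp at h4
    have h6 : ∫⁻ x, T x {true} ∂κ ≠ ⊤ := fun h => by rw [h] at h4; simp at h4
    have h7 := congrArg ENNReal.toReal h4
    rw [ENNReal.toReal_add h5 h6, ENNReal.toReal_one] at h7
    have h8 : (2 / 3 : ℝ) < (∫⁻ x, T x {false} ∂κ).toReal := by
      have := (ENNReal.toReal_lt_toReal (by finiteness) h5).2 h3
      simpa using this
    linarith
  have halt : ∀ v : V, 2 / 3 - 1 / 20 ≤ ∫ x, f x * ∏ i, q v (x i) ∂κ := by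
    intro v
    obtain ⟨Q, hQ1, hQ2⟩ := exists_isCorruptedLaw_hiddenDensity hR hg hb ha ha8 h0 hτ hε ht
      (hunit v) n
    have h2 := (hT (a • signedDirection e v) (isSparse_smul_signedDirection e v a hks) Q hQ1).2
      (by rw [norm_smul, hunit v, Real.norm_eq_abs, abs_of_pos ha, mul_one])
    rw [bind_kernel_apply] at h2
    have h3 := h2.trans_le (hQ2 F hFm hF1)
    have hPm : Measurable fun x : Fin n → Observation d => f x * ∏ i, q v (x i) :=
      hfm.mul (Finset.measurable_prod _ fun i _ => (hqm v).comp (measurable_pi_apply i))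
    have hP0 : ∀ x : Fin n → Observation d, 0 ≤ f x * ∏ i, q v (x i) := fun x =>
      mul_nonneg (hf0 x) (Finset.prod_nonneg fun i _ => hq0 v (x i))
    have hPi : Integrable (fun x : Fin n → Observation d => f x * ∏ i, q v (x i)) κ := by
      refine integrable_of_measurable_of_bounded (R := 1 * 2 ^ n) hPm fun x => ?_
      rw [abs_mul, Finset.abs_prod]
      gcongr
      · exact hf1 x
      · calc ∏ i, |q v (x i)| ≤ ∏ _i : Fin n, (2 : ℝ) :=
            Finset.prod_le_prod (fun _ _ => abs_nonneg _) fun i _ =>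
              abs_hiddenDensity_le hR hb ha _ _
          _ = 2 ^ n := by simp
    have hI0 : 0 ≤ ∫ x, f x * ∏ i, q v (x i) ∂κ := integral_nonneg fun x => hP0 x
    have h4 : ∫⁻ x, F x * ENNReal.ofReal (∏ i, q v (x i)) ∂κ =
        ENNReal.ofReal (∫ x, f x * ∏ i, q v (x i) ∂κ) := by
      rw [ofReal_integral_eq_lintegral_ofReal hPi (ae_of_all _ hP0)]
      refine lintegral_congr fun x => ?_
      rw [hFf, ENNReal.ofReal_mul (hf0 x)]
    have h5 : (2 / 3 : ENNReal) < ENNReal.ofReal ((∫ x, f x * ∏ i, q v (x i) ∂κ) + 1 / 20) := by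
      rw [ENNReal.ofReal_add hI0 (by norm_num), ← h4]
      refine h3.trans_le ?_
      have : ε / 20 / ε = 1 / 20 := by field_simp
      rw [this]
    have h6 := (ENNReal.toReal_lt_toReal (by finiteness) ENNReal.ofReal_ne_top).2 h5
    rw [ENNReal.toReal_ofReal (by positivity)] at h6
    have h7 : (2 / 3 : ENNReal).toReal = 2 / 3 := by simp
    rw [h7] at h6
    linarith
  -- The mean rejection probability under the mixture exceeds that under the null by at least `2/3 -
  -- 1/20 - 1/3`, which is more than the `1/4` allowed here.
  have hmain := average_integral_prod_sub_le μ hqm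
    (fun v x => abs_hiddenDensity_le hR hb ha _ _) hq1 n (by norm_num : (0 : ℝ) < 1 / 4) hsum hfm hf1
  have hcard : (0 : ℝ) < Fintype.card V := by exact_mod_cast Fintype.card_pos
  have havg : 2 / 3 - 1 / 20 ≤ (∑ v, ∫ x, f x * ∏ i, q v (x i) ∂κ) / Fintype.card V := by
    rw [le_div_iff₀ hcard]
    calc (2 / 3 - 1 / 20 : ℝ) * Fintype.card V = ∑ _v : V, (2 / 3 - 1 / 20 : ℝ) := by
          rw [Finset.sum_const, Finset.card_univ, nsmul_eq_mul, mul_comm]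
      _ ≤ _ := Finset.sum_le_sum fun v _ => halt v
  linarith

/-- Without samples nothing can be distinguished. -/
lemma not_robustlyDistinguishes_of_no_samples {d : ℕ} {s ε a : ℝ} (hd : 0 < d) (hs : 1 ≤ s)
    (hε : 0 < ε) (ha : 0 < a) (T : Kernel (Fin 0 → Observation d) Bool) [IsMarkovKernel T] :
    ¬ RobustlyDistinguishes T s ε a := by
  intro hT
  let θ : EuclideanSpace ℝ (Fin d) := EuclideanSpace.single ⟨0, hd⟩ a
  have hθs : IsSparse s θ := by
    refine le_trans ?_ hs
    have hsub : {j : Fin d | θ j ≠ 0} ⊆ {⟨0, hd⟩} := fun j hj => by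
      by_contra hne
      exact hj (by simp [θ, show j ≠ ⟨0, hd⟩ from hne])
    have := Set.ncard_le_ncard hsub
    rw [Set.ncard_singleton] at this
    exact_mod_cast this
  obtain ⟨Q₀, hQ₀, hle₀⟩ := exists_isCorruptedLaw_self hε 0
    (regressionLaw (0 : EuclideanSpace ℝ (Fin d)))
  obtain ⟨Q₁, hQ₁, hle₁⟩ := exists_isCorruptedLaw_self hε 0 (regressionLaw θ)
  have h0 := (hT 0 (by simp [IsSparse]; linarith) Q₀ hQ₀).1 (by simp)
  have h1 := (hT θ hθs Q₁ hQ₁).2 (by simp [θ, abs_of_pos ha])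
  rw [bind_kernel_apply] at h0 h1
  have h2 := h0.trans_le (hle₀ _ (T.measurable_coe (measurableSet_singleton false))
    fun x => prob_le_one)
  have h3 := h1.trans_le (hle₁ _ (T.measurable_coe (measurableSet_singleton true))
    fun x => prob_le_one)
  have hpi : (Measure.pi fun _ : Fin 0 => regressionLaw θ) =
      Measure.pi fun _ : Fin 0 => regressionLaw (0 : EuclideanSpace ℝ (Fin d)) := by
    rw [Measure.pi_of_empty, Measure.pi_of_empty]
  rw [hpi] at h3
  have h5 := ENNReal.add_lt_add h2 h3
  have h6 : (1 : ENNReal) ≤ 2 / 3 + 2 / 3 := by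
    rw [← ENNReal.toReal_le_toReal (by finiteness) (by finiteness),
      ENNReal.toReal_add (by finiteness) (by finiteness)]
    norm_num
  rw [lintegral_kernel_bool_add] at h5
  exact absurd h5 (not_lt.2 h6)

/-! ### Choice of constants. -/

theorem mainTheorem4 :
    ∃ γ₀ : ℝ, 0 < γ₀ ∧ ∃ C₀ : ℝ, 0 < C₀ ∧
      ∀ C : ℝ, C₀ ≤ C → ∀ δ : ℝ, 0 < δ → δ < 1 →
        ∃ c : ℝ, 0 < c ∧
          ∀ (d n : ℕ) (γ : ℝ), 0 < γ → γ ≤ γ₀ →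
            (∃ T : Kernel (Fin n → Observation d) Bool, IsMarkovKernel T ∧
              RobustlyDistinguishes T ((d : ℝ) ^ (1 - δ)) (γ / C) γ) →
            c * min ((d : ℝ) ^ (1 - δ) * Real.log d) (1 / γ ^ 4) ≤ n := by
  refine ⟨1, one_pos, 1, one_pos, fun C hC δ hδ hδ1 => ?_⟩
  have hC0 : 0 < C := by linarith
  have hδ' : 0 < 1 - δ := by linarith
  -- The distance budget `ε / 20 = γ / (20 C)` is split in halves: this `τ` takes one, and `γ ≤ a₀`
  -- keeps the second-order terms `A γ²` within the other. Thus `g`, `R` and `a₀` depend on `C`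
  -- alone.
  obtain ⟨g, R, hR, hg, hb, hsupp, h0, h1, hτ⟩ :=
    exists_bounded_orthogonal_approx (τ := 1 / (40 * C)) (by positivity)
  set D : ℝ := R ^ 2 * (4 + (2 * Real.exp (R ^ 2) + 4 * R ^ 4 * Real.exp (R ^ 2) +
      2 * R ^ 2)) with hD
  have hD0 : 0 < D := by positivity
  set A : ℝ := 130 * (∫ x : ℝ, Real.exp (x ^ 2 / 4) ∂(gaussianReal 0 1)) ^ 2 + R ^ 2 with hA
  have hA0 : 0 < A := by positivity
  set a₀ : ℝ := min (1 / 8) (1 / (40 * C * A)) with ha₀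
  have ha₀0 : 0 < a₀ := by positivity
  refine ⟨min (a₀ ^ 4) (δ * (1 - δ) / (1024 * D)), by positivity, ?_⟩
  rintro d n γ hγ - ⟨T, hTm, hT⟩
  set c : ℝ := min (a₀ ^ 4) (δ * (1 - δ) / (1024 * D)) with hc
  have hc0 : 0 < c := by positivity
  have hε : 0 < γ / C := by positivity
  by_contra! hlt
  rcases lt_or_ge d 2 with hd | hd
  · have hlog : Real.log d = 0 := by interval_cases d <;> simp
    rw [hlog, mul_zero, min_eq_left (by positivity), mul_zero] at hlt
    exact absurd hlt (not_lt.2 (Nat.cast_nonneg n))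
  rcases Nat.eq_zero_or_pos n with hn | hn
  · subst hn
    have hd1 : (1 : ℝ) ≤ d := by exact_mod_cast (by omega : 1 ≤ d)
    exact not_robustlyDistinguishes_of_no_samples (by omega) (Real.one_le_rpow hd1 hδ'.le) hε hγ T hT
  have hn1 : (1 : ℝ) ≤ n := by exact_mod_cast hn
  -- For larger `γ` the claim is trivial: `c ≤ a₀⁴` would give `c / γ⁴ < 1 ≤ n`. This uses `n ≥ 1`,
  -- so the case of no samples had to be excluded separately.
  have hγa : γ ≤ a₀ := by
    have h2 : (1 : ℝ) < c * (1 / γ ^ 4) :=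
      (hn1.trans_lt hlt).trans_le (by gcongr; exact min_le_right _ _)
    have h3 : γ ^ 4 < a₀ ^ 4 := by
      rw [mul_one_div, one_lt_div (by positivity)] at h2
      exact h2.trans_le (min_le_left _ _)
    exact (lt_of_pow_lt_pow_left₀ 4 ha₀0.le h3).le
  refine not_robustlyDistinguishes hδ hδ1 hd hR hg hb hsupp h0 h1 hτ hγ
    (hγa.trans (min_le_left _ _)) hε ?_ ?_ T hT
  · have h2 : A * γ ≤ 1 / (40 * C) := by
      calc A * γ ≤ A * (1 / (40 * C * A)) := by gcongr; exact hγa.trans (min_le_right _ _)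
        _ = 1 / (40 * C) := by field_simp
    have h3 : 130 * (∫ x : ℝ, Real.exp (x ^ 2 / 4) ∂(gaussianReal 0 1)) ^ 2 * γ + 1 / (40 * C)
        + R ^ 2 * γ ≤ 1 / (20 * C) := by
      have : 1 / (20 * C) = 1 / (40 * C) + 1 / (40 * C) := by field_simp; norm_num
      rw [this]
      rw [hA] at h2
      linarith
    calc _ ≤ γ * (1 / (20 * C)) := by gcongr
      _ = γ / C / 20 := by field_simp
  · have hd1 : (1 : ℝ) ≤ d := by exact_mod_cast (by omega : 1 ≤ d)
    have hlog : 0 ≤ Real.log d := Real.log_nonneg hd1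
    calc n * D ≤ (c * ((d : ℝ) ^ (1 - δ) * Real.log d)) * D := by
          gcongr; exact hlt.le.trans (by gcongr; exact min_le_left _ _)
      _ ≤ (δ * (1 - δ) / (1024 * D) * ((d : ℝ) ^ (1 - δ) * Real.log d)) * D := by
          gcongr; exact min_le_right _ _
      _ = δ * (1 - δ) / 1024 * ((d : ℝ) ^ (1 - δ) * Real.log d) := by field_simp
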